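/- **Model.** There are $n$ nodes, joined pairwise by authenticated asynchronous channels. The adversary schedules all deliveries and local steps, chooses the inputs, may corrupt nodes at any time (at most $t$ in total), and chooses every message of a corrupted (dishonest) node. A common coin with a given identifier returns the same value to all honest nodes that activate it; its value may be arbitrary. An $(n,k)$ error correction code consists of an encoder $w\mapsto(\mathrm{Enc}_1(w),\dots,\mathrm{Enc}_n(w))$ and a decoder $\mathrm{Dec}$ that recovers $w$ from any set of at least $2e+k$ observed symbols of which at most $e$ are wrong. A protocol has *agreement* if in every execution no two honest nodes output different values. **OciorMVBA-RR-IT.** Let $\mathrm{Predicate}$ be a $\{\mathrm{true},\mathrm{false}\}$-valued function on messages, let an $(n,t+1)$ code be given, and let $\Pi$ be a multi-valued asynchronous Byzantine agreement (ABA) protocol whose outputs are messages or a default value $\bot$. Node $i$, on an input $w_i$ with $\mathrm{Predicate}(w_i)=\mathrm{true}$, runs the following. 1. *Dispersal.* Send SHARE$(\mathrm{Enc}_j(w_i))$ to each node $j$. On the first SHARE$(y)$ from node $j$, record $S[j]=y$ and answer VOTE. After $n-t$ VOTEs, send ELECTION to all. After $n-t$ ELECTIONs or $t+1$ CONFIRMs,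 send CONFIRM to all (once). After $2t+1$ CONFIRMs, send CONFIRM if this was not done, and return the record $S$ (unset entries are $\bot$). 2. *Rounds $r=1,\dots,n$.* - Obtain $\ell\in\{1,\dots,n\}$ from the common coin of round $r$. - Send ECHO$(\ell,S[\ell])$ to all, wait for ECHO$(\ell,\cdot)$ messages from $n-t$ nodes, and decode them to $\bar w$. - Call instance $\ell$ of $\Pi$ with input $\bar w$, and let $\hat w$ be its output. If $\ell$ was elected before, the output of the existing instance is used. - If $\hat w\neq\bot$ and $\mathrm{Predicate}(\hat w)=\mathrm{true}$, output $\hat w$ and terminate; otherwise go to the next round. **The ABA protocol $\Pi_0$** (coded exchange with one binary agreement). Let $k=\lfloor t/5\rfloor+1$ and let an $(n,k)$ code be given. Node $i$ with input $w_i$ sends $(\mathrm{Enc}_j(w_i),\mathrm{Enc}_i(w_i))$ to each node $j$. Node $j$ is *linked* (*unlinked*) at $i$ if the pair received from $j$ equals (differs from) $(\mathrm{Enc}_i(w_i),\mathrm{Enc}_j(w_i))$. - Node $i$ sends to all a first indicator: $1$ once $n-2t$ nodes are linked, or $0$ once $t+1$ nodes are unlinked (whichever is done first). - For each phase of indicators,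 a node *succeeds* at $i$ if it sent $1$ and is linked, and *fails* at $i$ if it sent $0$, or sent $1$ and is unlinked. - Node $i$ sends to all a second indicator: $1$ if its first indicator is $1$ and $n-2t$ nodes succeed in the first phase; $0$ if its first indicator is $0$ or $t+1$ nodes fail in the first phase. - Node $i$ inputs into a binary agreement $1$ once $n-2t$ nodes succeed in the second phase, or $0$ once $t+1$ nodes fail in it. - If the binary agreement outputs $0$, output $\bot$. If it outputs $1$ and the second indicator of $i$ is $1$, output $w_i$. If it outputs $1$ and the second indicator of $i$ is $0$: wait until the pairs received from $t+1$ nodes that sent second indicator $1$ have the same first entry $y$, and send $y$ to all as a corrected symbol; then, from the own symbols of the nodes that sent second indicator $1$ and the corrected symbols of the others, decode $w$, and output $w$ once at least $k+t$ of these symbols agree with $\mathrm{Enc}(w)$. The binary agreement is the Mostéfaoui–Moumen–Raynal protocol, with one common coin bit per round. In round $r$ a node does the following. - It sends BVAL$(r,\mathit{est})$, relays BVAL$(r,b)$ after $t+1$ copies, and accepts $b$ in round $r$ after $2t+1$ copies. - It sends AUX$(r,b)$ for one accepted $b$, and waits for AUX messages of $n-t$ nodes all of whose values are accepted. Let $V$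 be the set of these values and $s$ the coin of the round. - If $V=\{b\}$, then $\mathit{est}:=b$, and if moreover $b=s$ it sends FINISH$(b)$ (at most one FINISH is sent); otherwise $\mathit{est}:=s$. FINISH$(b)$ is relayed after $t+1$ copies, and after $2t+1$ copies a node outputs $b$ and terminates. **Theorem (Agreement).** Let $n\ge 5t+1$. In OciorMVBA-RR-IT with $\Pi=\Pi_0$, if two honest nodes output $\boldsymbol w'$ and $\boldsymbol w''$, respectively, then $\boldsymbol w'=\boldsymbol w''$. More generally, the same holds with any protocol $\Pi$ that itself has agreement in the presence of at most $t$ dishonest nodes. -/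

import Mathlib

/-! ## Asynchronous message-passing protocols with common coins and an adaptive adversary -/

/-- Number of nodes with a given property. -/
noncomputable def nodeCount {n : ℕ} (P : Fin n → Prop) : ℕ := by
  classical exact (Finset.univ.filter P).card

/-- What can trigger an atomic step of an honest node: the arrival of its input, the arrival of a
message over the (authenticated) channel from a node, the return of a common coin that the node has
activated, or nothing external (an enabled local rule is executed). -/
inductive NodeEvent (n : ℕ) (I Msg CoinId : Type) (CoinVal : CoinId → Type) : Type where
  | input (v : I)
  | recv (sender : Fin n) (m : Msg)
  | coin (id : CoinId) (v : CoinVal id)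
  | tau

/-- What a node does in an atomic step, apart from changing its state: it sends messages (given as
pairs of a destination and a content), activates common coins and possibly outputs a value. -/
structure Effects (n : ℕ) (O Msg CoinId : Type) : Type where
  sends : List (Fin n × Msg) := []
  toss : List CoinId := []
  out : Option O := none

/-- The same message for each of the `n` nodes. -/
def toAll {n : ℕ} {Msg : Type} (m : Msg) : List (Fin n × Msg) :=
  (List.finRange n).map fun j => (j, m)

/-- A protocol for `n` nodes with inputs in `I` and outputs in `O`: the program that the honest
nodes run. `step i s ev s' e` says that in state `s`, on the event `ev`, node `i` may move to the
state `s'` with the effects `e`. A message whose handler is not enabled just stays in its channel. -/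
structure Protocol (n : ℕ) (I O : Type) : Type 1 where
  Msg : Type
  State : Type
  CoinId : Type
  CoinVal : CoinId → Type
  init : State
  step : Fin n → State → NodeEvent n I Msg CoinId CoinVal → State → Effects n O Msg CoinId → Prop

/-- A global configuration. -/
structure Config {n : ℕ} {I O : Type} (P : Protocol n I O) : Type where
  /-- local states -/
  state : Fin n → P.State
  /-- messages in transit: sender, receiver, content -/
  net : Multiset (Fin n × Fin n × P.Msg)
  /-- coins activated by a node and not yet returned to it -/
  pending : Multiset (Fin n × P.CoinId)
  /-- inputs received so far -/
  inputs : Fin n → Option I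
  /-- values output so far, with the node that has output them -/
  outs : Multiset (Fin n × O)
  /-- the dishonest nodes -/
  corrupted : Finset (Fin n)

namespace Config

variable {n : ℕ} {I O : Type} {P : Protocol n I O}

/-- The initial configuration. -/
def start (P : Protocol n I O) : Config P where
  state := fun _ => P.init
  net := 0
  pending := 0
  inputs := fun _ => none
  outs := 0
  corrupted := ∅

/-- Node `p` moves to the state `s` with the effects `e`. -/
def commit (c : Config P) (p : Fin n) (s : P.State) (e : Effects n O P.Msg P.CoinId) : Config P :=
  { c with
    state := Function.update c.state p s
    net := c.net + Multiset.ofList (e.sends.map fun x => (p, x.1, x.2))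
    pending := c.pending + Multiset.ofList (e.toss.map fun id => (p, id))
    outs := c.outs + Multiset.ofList (e.out.toList.map fun v => (p, v)) }

end Config

/-- One step of an execution in which at most `t` nodes are ever corrupted. The order of the steps
(hence the delay of every message), the inputs, the corruptions, which may happen at any time, and
all the messages of dishonest nodes are up to the adversary. The ideal common coin `coin` returns
the same value to all nodes that activate it; nothing is assumed about the values of the coins or
about what the adversary knows of them. -/
inductive ExecStep {n : ℕ} {I O : Type} (P : Protocol n I O) (t : ℕ)
    (coin : (id : P.CoinId) → P.CoinVal id) : Config P → Config P → Prop where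
  | input (c : Config P) (p : Fin n) (v : I) (s : P.State) (e : Effects n O P.Msg P.CoinId)
      (hp : p ∉ c.corrupted) (hin : c.inputs p = none)
      (hs : P.step p (c.state p) (.input v) s e) :
      ExecStep P t coin c
        (Config.commit { c with inputs := Function.update c.inputs p (some v) } p s e)
  | deliver (c : Config P) (p q : Fin n) (m : P.Msg) (rest : Multiset (Fin n × Fin n × P.Msg))
      (s : P.State) (e : Effects n O P.Msg P.CoinId)
      (hp : p ∉ c.corrupted) (hm : c.net = (q, p, m) ::ₘ rest)
      (hs : P.step p (c.state p) (.recv q m) s e) :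
      ExecStep P t coin c (Config.commit { c with net := rest } p s e)
  | forge (c : Config P) (p q : Fin n) (m : P.Msg)
      (s : P.State) (e : Effects n O P.Msg P.CoinId)
      (hp : p ∉ c.corrupted) (hq : q ∈ c.corrupted)
      (hs : P.step p (c.state p) (.recv q m) s e) :
      ExecStep P t coin c (Config.commit c p s e)
  | coin (c : Config P) (p : Fin n) (id : P.CoinId) (rest : Multiset (Fin n × P.CoinId))
      (s : P.State) (e : Effects n O P.Msg P.CoinId)
      (hp : p ∉ c.corrupted) (hm : c.pending = (p, id) ::ₘ rest)
      (hs : P.step p (c.state p) (.coin id (coin id)) s e) :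
      ExecStep P t coin c (Config.commit { c with pending := rest } p s e)
  | tau (c : Config P) (p : Fin n) (s : P.State) (e : Effects n O P.Msg P.CoinId)
      (hp : p ∉ c.corrupted) (hs : P.step p (c.state p) .tau s e) :
      ExecStep P t coin c (Config.commit c p s e)
  | corrupt (c : Config P) (p : Fin n) (ht : (insert p c.corrupted).card ≤ t) :
      ExecStep P t coin c { c with corrupted := insert p c.corrupted }

/-- The configurations that occur in executions with at most `t` dishonest nodes. -/
def Reachable {n : ℕ} {I O : Type} (P : Protocol n I O) (t : ℕ)
    (coin : (id : P.CoinId) → P.CoinVal id) (c : Config P) : Prop :=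
  Relation.ReflTransGen (ExecStep P t coin) (Config.start P) c

/-- In every execution with at most `t` dishonest nodes, whatever the values of the common coins,
no two honest nodes output different values. -/
def Agreement {n : ℕ} {I O : Type} (P : Protocol n I O) (t : ℕ) : Prop :=
  ∀ (coin : (id : P.CoinId) → P.CoinVal id) (c : Config P), Reachable P t coin c →
    ∀ (p q : Fin n) (u v : O), p ∉ c.corrupted → q ∉ c.corrupted →
      (p, u) ∈ c.outs → (q, v) ∈ c.outs → u = v

/-! ## Error correction codes -/

/-- An `(n, k)` error correction code for messages in `W` with symbols in `A`: the decoder, applied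
to the symbols observed at some of the `n` positions, corrects `e` errors whenever at least
`2 e + k` symbols are observed (as for Reed-Solomon codes). -/
structure ECC (n k : ℕ) (W A : Type) : Type where
  enc : W → Fin n → A
  dec : (Fin n → Option A) → W
  dec_correct : ∀ (w : W) (obs : Fin n → Option A) (e : ℕ),
    2 * e + k ≤ nodeCount (fun j => ∃ y, obs j = some y) →
    nodeCount (fun j => ∃ y, obs j = some y ∧ y ≠ enc w j) ≤ e →
    dec obs = w

/-! ## Asynchronous binary Byzantine agreement

The signature-free protocol of Mostéfaoui, Moumen and Raynal with one common coin per round, closed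
by an amplification step after which a node outputs and terminates. -/

namespace ABBA

inductive Msg : Type where
  | bval (r : ℕ) (b : Bool)
  | aux (r : ℕ) (b : Bool)
  | finish (b : Bool)

structure State (n : ℕ) : Type where
  /-- current round and estimate, once the input has arrived -/
  cur : Option (ℕ × Bool) := none
  bvalSent : Finset (ℕ × Bool) := ∅
  bvalRecv : Finset (ℕ × Bool × Fin n) := ∅
  binVals : Finset (ℕ × Bool) := ∅
  auxSent : Finset ℕ := ∅
  auxRecv : Finset (ℕ × Bool × Fin n) := ∅
  /-- the set of values collected in the current round, while its coin is awaited -/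
  vals : Option (Finset Bool) := none
  finishSent : Bool := false
  finishRecv : Finset (Bool × Fin n) := ∅
  halted : Bool := false

/-- The coin of round `r` is a bit. -/
abbrev Ev (n : ℕ) : Type := NodeEvent n Bool Msg ℕ (fun _ => Bool)

abbrev Eff (n : ℕ) : Type := Effects n Bool Msg ℕ

inductive Step (n t : ℕ) : State n → Ev n → State n → Eff n → Prop where
  | input (s : State n) (b : Bool) (h : s.halted = false) (hc : s.cur = none) :
      Step n t s (.input b)
        { s with cur := some (0, b), bvalSent := insert (0, b) s.bvalSent }
        { sends := toAll (.bval 0 b) }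
  | recvBval (s : State n) (j : Fin n) (r : ℕ) (b : Bool) (h : s.halted = false) :
      Step n t s (.recv j (.bval r b)) { s with bvalRecv := insert (r, b, j) s.bvalRecv } {}
  | recvAux (s : State n) (j : Fin n) (r : ℕ) (b : Bool) (h : s.halted = false)
      (hfirst : ∀ b', (r, b', j) ∉ s.auxRecv) :
      Step n t s (.recv j (.aux r b)) { s with auxRecv := insert (r, b, j) s.auxRecv } {}
  | recvFinish (s : State n) (j : Fin n) (b : Bool) (h : s.halted = false)
      (hfirst : ∀ b', (b', j) ∉ s.finishRecv) :
      Step n t s (.recv j (.finish b)) { s with finishRecv := insert (b, j) s.finishRecv } {}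
  | relayBval (s : State n) (r : ℕ) (b : Bool) (h : s.halted = false)
      (hn : t + 1 ≤ nodeCount fun j => (r, b, j) ∈ s.bvalRecv) (hs : (r, b) ∉ s.bvalSent) :
      Step n t s .tau { s with bvalSent := insert (r, b) s.bvalSent }
        { sends := toAll (.bval r b) }
  | addBin (s : State n) (r : ℕ) (b : Bool) (h : s.halted = false)
      (hn : 2 * t + 1 ≤ nodeCount fun j => (r, b, j) ∈ s.bvalRecv) :
      Step n t s .tau { s with binVals := insert (r, b) s.binVals } {}
  | sendAux (s : State n) (r : ℕ) (est b : Bool) (h : s.halted = false)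
      (hc : s.cur = some (r, est)) (hb : (r, b) ∈ s.binVals) (hs : r ∉ s.auxSent) :
      Step n t s .tau { s with auxSent := insert r s.auxSent } { sends := toAll (.aux r b) }
  /-- `V` is the set of the values of `aux` messages of at least `n - t` nodes -/
  | collect (s : State n) (r : ℕ) (est : Bool) (Q : Finset (Fin n)) (V : Finset Bool)
      (h : s.halted = false) (hc : s.cur = some (r, est)) (hv : s.vals = none)
      (hs : r ∈ s.auxSent) (hQ : n - t ≤ Q.card)
      (hQV : ∀ j ∈ Q, ∃ b ∈ V, (r, b, j) ∈ s.auxRecv)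
      (hVQ : ∀ b ∈ V, ∃ j ∈ Q, (r, b, j) ∈ s.auxRecv)
      (hbin : ∀ b ∈ V, (r, b) ∈ s.binVals) :
      Step n t s .tau { s with vals := some V } { toss := [r] }
  | coinMixed (s : State n) (r : ℕ) (est : Bool) (V : Finset Bool) (b : Bool)
      (h : s.halted = false) (hc : s.cur = some (r, est)) (hv : s.vals = some V)
      (hV : ∀ b', V ≠ {b'}) :
      Step n t s (.coin r b)
        { s with cur := some (r + 1, b), vals := none,
                 bvalSent := insert (r + 1, b) s.bvalSent }
        { sends := toAll (.bval (r + 1) b) }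
  | coinMiss (s : State n) (r : ℕ) (est b b' : Bool)
      (h : s.halted = false) (hc : s.cur = some (r, est)) (hv : s.vals = some {b})
      (hb : b' ≠ b) :
      Step n t s (.coin r b')
        { s with cur := some (r + 1, b), vals := none,
                 bvalSent := insert (r + 1, b) s.bvalSent }
        { sends := toAll (.bval (r + 1) b) }
  | coinHit (s : State n) (r : ℕ) (est b : Bool)
      (h : s.halted = false) (hc : s.cur = some (r, est)) (hv : s.vals = some {b}) :
      Step n t s (.coin r b)
        { s with cur := some (r + 1, b), vals := none, finishSent := true,
                 bvalSent := insert (r + 1, b) s.bvalSent }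
        { sends := (if s.finishSent = true then [] else toAll (.finish b)) ++
            toAll (.bval (r + 1) b) }
  | relayFinish (s : State n) (b : Bool) (h : s.halted = false)
      (hn : t + 1 ≤ nodeCount fun j => (b, j) ∈ s.finishRecv) (hs : s.finishSent = false) :
      Step n t s .tau { s with finishSent := true } { sends := toAll (.finish b) }
  | output (s : State n) (b : Bool) (h : s.halted = false)
      (hn : 2 * t + 1 ≤ nodeCount fun j => (b, j) ∈ s.finishRecv) (hs : s.finishSent = true) :
      Step n t s .tau { s with halted := true } { out := some b }

/-- The binary Byzantine agreement protocol. -/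
def protocol (n t : ℕ) : Protocol n Bool Bool where
  Msg := Msg
  State := State n
  CoinId := ℕ
  CoinVal := fun _ => Bool
  init := {}
  step := fun _ => Step n t

end ABBA

/-! ## Multi-valued asynchronous Byzantine agreement for `n ≥ 5 t + 1`

Coded symbols of an `(n, ⌊t/5⌋ + 1)` code are exchanged and two phases of success indicators are
computed from them; one binary agreement decides whether the nodes that succeeded in both phases
keep their message, in which case the other nodes correct their own coded symbol by the majority
rule and decode the message with online error correction, or whether all nodes output the default
value `none`. -/

namespace LiChen

/-- Dimension of the code. -/
def dim (t : ℕ) : ℕ := t / 5 + 1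

inductive Msg (A : Type) : Type where
  /-- `symbol y z` from node `j` to node `i` carries the `i`-th and the `j`-th coded symbol of the
  message of node `j` -/
  | symbol (y z : A)
  | si1 (b : Bool)
  | si2 (b : Bool)
  | correct (y : A)
  | abba (m : ABBA.Msg)

structure State (n : ℕ) (W A : Type) : Type where
  /-- the input message -/
  msg : Option W := none
  symRecv : Fin n → Option (A × A) := fun _ => none
  si1Sent : Option Bool := none
  si1Recv : Fin n → Option Bool := fun _ => none
  si2Sent : Option Bool := none
  si2Recv : Fin n → Option Bool := fun _ => none
  /-- the input to the binary agreement has been given -/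
  voted : Bool := false
  abba : ABBA.State n := {}
  abbaOut : Option Bool := none
  correctSent : Bool := false
  correctRecv : Fin n → Option A := fun _ => none
  halted : Bool := false

variable {n : ℕ} {W A : Type}

/-- At node `i`, the coded symbols received from node `j` match those of the own message. -/
def Linked {k : ℕ} (code : ECC n k W A) (i : Fin n) (s : State n W A) (j : Fin n) : Prop :=
  ∃ w, s.msg = some w ∧ s.symRecv j = some (code.enc w i, code.enc w j)

/-- At node `i`, the coded symbols received from node `j` do not match those of the own message. -/
def Unlinked {k : ℕ} (code : ECC n k W A) (i : Fin n) (s : State n W A) (j : Fin n) : Prop :=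
  ∃ w yz, s.msg = some w ∧ s.symRecv j = some yz ∧ yz ≠ (code.enc w i, code.enc w j)

/-- Node `j` reported success in the phase with received indicators `si`, and is linked. -/
def Succ {k : ℕ} (code : ECC n k W A) (i : Fin n) (s : State n W A) (si : Fin n → Option Bool)
    (j : Fin n) : Prop :=
  si j = some true ∧ Linked code i s j

/-- Node `j` reported failure in the phase with received indicators `si`, or reported success but
is not linked. -/
def Fail {k : ℕ} (code : ECC n k W A) (i : Fin n) (s : State n W A) (si : Fin n → Option Bool)
    (j : Fin n) : Prop :=
  si j = some false ∨ (si j = some true ∧ Unlinked code i s j)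

/-- The symbols available for decoding: the own symbols of the nodes that reported success in the
second phase, and the corrected symbols of other nodes. -/
def symbols (s : State n W A) (j : Fin n) : Option A :=
  if s.si2Recv j = some true ∧ (s.symRecv j).isSome then (s.symRecv j).map Prod.snd
  else s.correctRecv j

abbrev Ev (n : ℕ) (W A : Type) : Type := NodeEvent n W (Msg A) ℕ (fun _ => Bool)

abbrev Eff (n : ℕ) (W A : Type) : Type := Effects n (Option W) (Msg A) ℕ

/-- The effects of a step of the binary agreement, as effects of the calling protocol. -/
def lift (e : ABBA.Eff n) : Eff n W A where
  sends := e.sends.map fun x => (x.1, .abba x.2)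
  toss := e.toss

/-- The state after a step of the binary agreement. -/
def withABBA (s : State n W A) (a : ABBA.State n) (e : ABBA.Eff n) : State n W A :=
  { s with abba := a, abbaOut := e.out.or s.abbaOut }

inductive Step (n t : ℕ) {W A : Type} (code : ECC n (dim t) W A) (i : Fin n) :
    State n W A → Ev n W A → State n W A → Eff n W A → Prop where
  | input (s : State n W A) (w : W) (h : s.halted = false) (hw : s.msg = none) :
      Step n t code i s (.input w) { s with msg := some w }
        { sends := (List.finRange n).map fun j => (j, .symbol (code.enc w j) (code.enc w i)) }
  | recvSymbol (s : State n W A) (j : Fin n) (y z : A) (h : s.halted = false)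
      (hfirst : s.symRecv j = none) :
      Step n t code i s (.recv j (.symbol y z))
        { s with symRecv := Function.update s.symRecv j (some (y, z)) } {}
  | recvSi1 (s : State n W A) (j : Fin n) (b : Bool) (h : s.halted = false)
      (hfirst : s.si1Recv j = none) :
      Step n t code i s (.recv j (.si1 b))
        { s with si1Recv := Function.update s.si1Recv j (some b) } {}
  | recvSi2 (s : State n W A) (j : Fin n) (b : Bool) (h : s.halted = false)
      (hfirst : s.si2Recv j = none) :
      Step n t code i s (.recv j (.si2 b))
        { s with si2Recv := Function.update s.si2Recv j (some b) } {}
  | recvCorrect (s : State n W A) (j : Fin n) (y : A) (h : s.halted = false)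
      (hfirst : s.correctRecv j = none) :
      Step n t code i s (.recv j (.correct y))
        { s with correctRecv := Function.update s.correctRecv j (some y) } {}
  | si1One (s : State n W A) (h : s.halted = false) (hs : s.si1Sent = none)
      (hn : n - 2 * t ≤ nodeCount (Linked code i s)) :
      Step n t code i s .tau { s with si1Sent := some true } { sends := toAll (.si1 true) }
  | si1Zero (s : State n W A) (h : s.halted = false) (hs : s.si1Sent = none)
      (hn : t + 1 ≤ nodeCount (Unlinked code i s)) :
      Step n t code i s .tau { s with si1Sent := some false } { sends := toAll (.si1 false) }
  | si2One (s : State n W A) (h : s.halted = false) (hs : s.si2Sent = none)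
      (h1 : s.si1Sent = some true) (hn : n - 2 * t ≤ nodeCount (Succ code i s s.si1Recv)) :
      Step n t code i s .tau { s with si2Sent := some true } { sends := toAll (.si2 true) }
  | si2Zero (s : State n W A) (h : s.halted = false) (hs : s.si2Sent = none)
      (hn : s.si1Sent = some false ∨ t + 1 ≤ nodeCount (Fail code i s s.si1Recv)) :
      Step n t code i s .tau { s with si2Sent := some false } { sends := toAll (.si2 false) }
  | voteOne (s : State n W A) (a : ABBA.State n) (e : ABBA.Eff n) (h : s.halted = false)
      (hv : s.voted = false) (hn : n - 2 * t ≤ nodeCount (Succ code i s s.si2Recv))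
      (ha : (ABBA.protocol n t).step i s.abba (.input true) a e) :
      Step n t code i s .tau { withABBA s a e with voted := true } (lift e)
  | voteZero (s : State n W A) (a : ABBA.State n) (e : ABBA.Eff n) (h : s.halted = false)
      (hv : s.voted = false) (hn : t + 1 ≤ nodeCount (Fail code i s s.si2Recv))
      (ha : (ABBA.protocol n t).step i s.abba (.input false) a e) :
      Step n t code i s .tau { withABBA s a e with voted := true } (lift e)
  | abbaRecv (s : State n W A) (j : Fin n) (m : ABBA.Msg) (a : ABBA.State n) (e : ABBA.Eff n)
      (h : s.halted = false) (ha : (ABBA.protocol n t).step i s.abba (.recv j m) a e) :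
      Step n t code i s (.recv j (.abba m)) (withABBA s a e) (lift e)
  | abbaCoin (s : State n W A) (r : ℕ) (b : Bool) (a : ABBA.State n) (e : ABBA.Eff n)
      (h : s.halted = false) (ha : (ABBA.protocol n t).step i s.abba (.coin r b) a e) :
      Step n t code i s (.coin r b) (withABBA s a e) (lift e)
  | abbaTau (s : State n W A) (a : ABBA.State n) (e : ABBA.Eff n)
      (h : s.halted = false) (ha : (ABBA.protocol n t).step i s.abba .tau a e) :
      Step n t code i s .tau (withABBA s a e) (lift e)
  | outputDefault (s : State n W A) (w : W) (h : s.halted = false) (ha : s.abbaOut = some false)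
      (hw : s.msg = some w) :
      Step n t code i s .tau { s with halted := true } { out := some none }
  | outputOwn (s : State n W A) (w : W) (h : s.halted = false) (ha : s.abbaOut = some true)
      (h2 : s.si2Sent = some true) (hw : s.msg = some w) :
      Step n t code i s .tau { s with halted := true } { out := some (some w) }
  /-- majority rule for the own coded symbol -/
  | sendCorrect (s : State n W A) (y : A) (h : s.halted = false) (ha : s.abbaOut = some true)
      (h2 : s.si2Sent = some false) (hs : s.correctSent = false)
      (hn : t + 1 ≤ nodeCount fun j => s.si2Recv j = some true ∧ ∃ z, s.symRecv j = some (y, z)) :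
      Step n t code i s .tau { s with correctSent := true } { sends := toAll (.correct y) }
  /-- online error correction -/
  | outputDecoded (s : State n W A) (v w : W) (h : s.halted = false) (ha : s.abbaOut = some true)
      (hv : s.msg = some v) (h2 : s.si2Sent = some false) (hs : s.correctSent = true)
      (hw : w = code.dec (symbols s))
      (hn : dim t + t ≤ nodeCount fun j => symbols s j = some (code.enc w j)) :
      Step n t code i s .tau { s with halted := true } { out := some (some w) }

/-- The multi-valued Byzantine agreement protocol. -/
def protocol (n t : ℕ) {W A : Type} (code : ECC n (dim t) W A) : Protocol n W (Option W) where
  Msg := Msg A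
  State := State n W A
  CoinId := ℕ
  CoinVal := fun _ => Bool
  init := {}
  step := Step n t code

end LiChen

/-! ## OciorMVBA-RR-IT -/

namespace MVBARR

inductive Msg (n : ℕ) (A M : Type) : Type where
  /-- dispersal -/
  | share (y : A)
  | vote
  | election
  | confirm
  /-- retrieval of the message dispersed by node `l` -/
  | echo (l : Fin n) (y : Option A)
  /-- Byzantine agreement instance `l` -/
  | aba (l : Fin n) (m : M)

/-- Control location in the main program. -/
inductive Loc (n : ℕ) : Type where
  /-- no (valid) input yet -/
  | idle
  /-- in the dispersal subprotocol -/
  | dispersing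
  /-- round `r`: waiting for the election -/
  | electing (r : ℕ)
  /-- round `r`: in data retrieval for the elected node `l` -/
  | retrieving (r : ℕ) (l : Fin n)
  /-- round `r`: waiting for the Byzantine agreement instance `l` -/
  | agreeing (r : ℕ) (l : Fin n)
  /-- the loop has been left after the last round without output -/
  | exhausted
  /-- output and terminated -/
  | terminated

structure State (n : ℕ) (W A S : Type) : Type where
  loc : Loc n
  /-- dispersal: shares received so far -/
  shares : Fin n → Option A
  voteRecv : Finset (Fin n)
  electionSent : Bool
  electionRecv : Finset (Fin n)
  confirmSent : Bool
  confirmRecv : Finset (Fin n)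
  /-- the share record returned by the dispersal -/
  record : Fin n → Option A
  /-- `echoRecv l j`: the symbol received from node `j` in the retrieval for node `l` -/
  echoRecv : Fin n → Fin n → Option (Option A)
  /-- instances of the Byzantine agreement: local states, inputs given, outputs -/
  aba : Fin n → S
  abaStarted : Finset (Fin n)
  abaOut : Fin n → Option (Option W)

variable {n : ℕ} {W A : Type}

/-- The dispersal subprotocol has not returned yet. -/
def Dispersal {S : Type} (s : State n W A S) : Prop :=
  s.loc = .idle ∨ s.loc = .dispersing

/-- Common coins: one election per round, with values in the set of nodes, and the coins of the
Byzantine agreement instances. -/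
abbrev CoinId (aba : Protocol n W (Option W)) : Type := ℕ ⊕ (Fin n × aba.CoinId)

abbrev CoinVal (aba : Protocol n W (Option W)) : CoinId aba → Type :=
  Sum.elim (fun _ => Fin n) (fun x => aba.CoinVal x.2)

abbrev Ev (A : Type) (aba : Protocol n W (Option W)) : Type :=
  NodeEvent n W (Msg n A aba.Msg) (CoinId aba) (CoinVal aba)

abbrev Eff (A : Type) (aba : Protocol n W (Option W)) : Type :=
  Effects n W (Msg n A aba.Msg) (CoinId aba)

/-- The effects of a step of the agreement instance `l`, as effects of the calling protocol. -/
def lift (aba : Protocol n W (Option W)) (l : Fin n)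
    (e : Effects n (Option W) aba.Msg aba.CoinId) : Eff A aba where
  sends := e.sends.map fun x => (x.1, .aba l x.2)
  toss := e.toss.map fun id => .inr (l, id)

/-- The state after a step of the agreement instance `l`. -/
def withABA (aba : Protocol n W (Option W)) (s : State n W A aba.State) (l : Fin n)
    (a : aba.State) (e : Effects n (Option W) aba.Msg aba.CoinId) : State n W A aba.State :=
  { s with
    aba := Function.update s.aba l a
    abaOut := Function.update s.abaOut l (e.out.or (s.abaOut l)) }

inductive Step (n t : ℕ) {W A : Type} (pred : W → Bool) (code : ECC n (t + 1) W A)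
    (aba : Protocol n W (Option W)) (i : Fin n) :
    State n W A aba.State → Ev A aba → State n W A aba.State → Eff A aba → Prop where
  /- The dispersal subprotocol. -/
  | input (s : State n W A aba.State) (w : W) (h : s.loc = .idle) (hw : pred w = true) :
      Step n t pred code aba i s (.input w) { s with loc := .dispersing }
        { sends := (List.finRange n).map fun j => (j, .share (code.enc w j)) }
  | recvShare (s : State n W A aba.State) (j : Fin n) (y : A) (h : Dispersal s)
      (hfirst : s.shares j = none) :
      Step n t pred code aba i s (.recv j (.share y))
        { s with shares := Function.update s.shares j (some y) } { sends := [(j, .vote)] }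
  | recvVote (s : State n W A aba.State) (j : Fin n) (h : Dispersal s) :
      Step n t pred code aba i s (.recv j .vote)
        { s with voteRecv := insert j s.voteRecv } {}
  | recvElection (s : State n W A aba.State) (j : Fin n) (h : Dispersal s) :
      Step n t pred code aba i s (.recv j .election)
        { s with electionRecv := insert j s.electionRecv } {}
  | recvConfirm (s : State n W A aba.State) (j : Fin n) (h : Dispersal s) :
      Step n t pred code aba i s (.recv j .confirm)
        { s with confirmRecv := insert j s.confirmRecv } {}
  | sendElection (s : State n W A aba.State) (h : Dispersal s)
      (hs : s.electionSent = false) (hn : n - t ≤ s.voteRecv.card) :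
      Step n t pred code aba i s .tau { s with electionSent := true }
        { sends := toAll .election }
  | sendConfirm (s : State n W A aba.State) (h : Dispersal s) (hs : s.confirmSent = false)
      (hn : n - t ≤ s.electionRecv.card ∨ t + 1 ≤ s.confirmRecv.card) :
      Step n t pred code aba i s .tau { s with confirmSent := true } { sends := toAll .confirm }
  /- The dispersal returns the share record, and the first election is called. -/
  | disperseReturn (s : State n W A aba.State) (h : s.loc = .dispersing)
      (hn : 2 * t + 1 ≤ s.confirmRecv.card) :
      Step n t pred code aba i s .tau
        { s with loc := .electing 1, confirmSent := true, record := s.shares }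
        { sends := if s.confirmSent = true then [] else toAll .confirm, toss := [.inl 1] }
  /- The election of round `r` returns `l`, for the first time: data retrieval is called. -/
  | elected (s : State n W A aba.State) (r : ℕ) (l : Fin n) (h : s.loc = .electing r)
      (hl : l ∉ s.abaStarted) :
      Step n t pred code aba i s (.coin (.inl r) l) { s with loc := .retrieving r l }
        { sends := toAll (.echo l (s.record l)) }
  /- The election returns a node that was elected before: the instance with this identifier
  exists already, and its output is used again. -/
  | electedAgain (s : State n W A aba.State) (r : ℕ) (l : Fin n) (h : s.loc = .electing r)
      (hl : l ∈ s.abaStarted) :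
      Step n t pred code aba i s (.coin (.inl r) l) { s with loc := .agreeing r l } {}
  | recvEcho (s : State n W A aba.State) (j l : Fin n) (y : Option A) (h : s.loc ≠ .terminated)
      (hfirst : s.echoRecv l j = none) :
      Step n t pred code aba i s (.recv j (.echo l y))
        { s with echoRecv := Function.update s.echoRecv l
                  (Function.update (s.echoRecv l) j (some y)) } {}
  /- Data retrieval decodes, and the agreement instance `l` is called with the result. -/
  | retrieved (s : State n W A aba.State) (r : ℕ) (l : Fin n) (w : W) (a : aba.State)
      (e : Effects n (Option W) aba.Msg aba.CoinId) (h : s.loc = .retrieving r l)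
      (hn : n - t ≤ nodeCount fun j => (s.echoRecv l j).isSome)
      (hw : w = code.dec fun j => (s.echoRecv l j).join)
      (ha : aba.step i (s.aba l) (.input w) a e) :
      Step n t pred code aba i s .tau
        { withABA aba s l a e with
          loc := .agreeing r l, abaStarted := insert l s.abaStarted }
        (lift aba l e)
  /- Steps of the agreement instances. -/
  | abaRecv (s : State n W A aba.State) (j l : Fin n) (m : aba.Msg) (a : aba.State)
      (e : Effects n (Option W) aba.Msg aba.CoinId) (h : s.loc ≠ .terminated)
      (ha : aba.step i (s.aba l) (.recv j m) a e) :
      Step n t pred code aba i s (.recv j (.aba l m)) (withABA aba s l a e) (lift aba l e)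
  | abaCoin (s : State n W A aba.State) (l : Fin n) (id : aba.CoinId) (v : aba.CoinVal id)
      (a : aba.State) (e : Effects n (Option W) aba.Msg aba.CoinId) (h : s.loc ≠ .terminated)
      (ha : aba.step i (s.aba l) (.coin id v) a e) :
      Step n t pred code aba i s (.coin (.inr (l, id)) v) (withABA aba s l a e) (lift aba l e)
  | abaTau (s : State n W A aba.State) (l : Fin n) (a : aba.State)
      (e : Effects n (Option W) aba.Msg aba.CoinId) (h : s.loc ≠ .terminated)
      (ha : aba.step i (s.aba l) .tau a e) :
      Step n t pred code aba i s .tau (withABA aba s l a e) (lift aba l e)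
  /- The agreement instance has an output, and the predicate is checked. -/
  | output (s : State n W A aba.State) (r : ℕ) (l : Fin n) (w : W) (h : s.loc = .agreeing r l)
      (ho : s.abaOut l = some (some w)) (hw : pred w = true) :
      Step n t pred code aba i s .tau { s with loc := .terminated } { out := some w }
  | nextRound (s : State n W A aba.State) (r : ℕ) (l : Fin n) (o : Option W)
      (h : s.loc = .agreeing r l) (ho : s.abaOut l = some o)
      (hw : ∀ w, o = some w → pred w = false) (hr : r < n) :
      Step n t pred code aba i s .tau { s with loc := .electing (r + 1) }
        { toss := [.inl (r + 1)] }
  | lastRound (s : State n W A aba.State) (r : ℕ) (l : Fin n) (o : Option W)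
      (h : s.loc = .agreeing r l) (ho : s.abaOut l = some o)
      (hw : ∀ w, o = some w → pred w = false) (hr : r = n) :
      Step n t pred code aba i s .tau { s with loc := .exhausted } {}

/-- OciorMVBA-RR-IT with external predicate `pred`, dispersal code `code`, and `aba` as the
protocol run in the Byzantine agreement instances. -/
def protocol (n t : ℕ) {W A : Type} (pred : W → Bool) (code : ECC n (t + 1) W A)
    (aba : Protocol n W (Option W)) : Protocol n W W where
  Msg := Msg n A aba.Msg
  State := State n W A aba.State
  CoinId := CoinId aba
  CoinVal := CoinVal aba
  init :=
    { loc := .idle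
      shares := fun _ => none
      voteRecv := ∅
      electionSent := false
      electionRecv := ∅
      confirmSent := false
      confirmRecv := ∅
      record := fun _ => none
      echoRecv := fun _ _ => none
      aba := fun _ => aba.init
      abaStarted := ∅
      abaOut := fun _ => none }
  step := Step n t pred code aba

end MVBARR

/-!
Seen from an instance of the agreement protocol, an execution of the calling protocol is an
execution of the instance with at most as many corrupted nodes, so all outputs of an instance at
honest nodes are equal. The coin elects the same instance for everybody in a round. If an honest
node has the acceptable output of the instance of round `r`, then no honest node gets past round `r`
without output. Hence all honest nodes that output something do so in the same round, from the same
instance.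

The binary agreement is the case `3 t < n` of the usual argument: after a round in which an
honest node has collected only the value that the coin shows, every estimate is that value, because
two quorums of `n - t` nodes share an honest one.

For the multi-valued protocol, let `H ≥ 4 t + 1` be the number of honest nodes. Honest nodes with
different messages are linked through at most `t / 5` symbols of each message. A node that claims
success in both phases is linked with `H - 2 t` honest nodes each of which is linked with `H - 2 t`
honest nodes. Double counting the links shows that its message is more frequent among honest nodes
than any other one. So there is only one such message, and what is decoded must be this message,
since the symbols in use all come from it.
-/

/-! ## Executions -/

@[simp]
theorem mem_toAll {n : ℕ} {M : Type} {m : M} {x : Fin n × M} : x ∈ toAll m ↔ x.2 = m := by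
  simp [toAll, Prod.ext_iff, eq_comm]

namespace NodeEvent

variable {n : ℕ} {I Msg CoinId : Type} {CoinVal : CoinId → Type}

/-- A coin that returns in the event shows the value prescribed by the common coin. -/
def AgreesWith (coin : (id : CoinId) → CoinVal id) : NodeEvent n I Msg CoinId CoinVal → Prop
  | .coin id v => v = coin id
  | _ => True

/-- A message that arrives in the event is related to its sender by `R`. -/
def Delivers (R : Fin n → Msg → Prop) : NodeEvent n I Msg CoinId CoinVal → Prop
  | .recv q m => R q m
  | _ => True

theorem Delivers.imp {R R' : Fin n → Msg → Prop} {ev : NodeEvent n I Msg CoinId CoinVal}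
    (h : ev.Delivers R) (hR : ∀ q m, R q m → R' q m) : ev.Delivers R' := by
  cases ev with
  | recv q m => exact hR q m h
  | _ => trivial

end NodeEvent

section Executions

variable {n : ℕ} {I O : Type} {P : Protocol n I O} {t : ℕ} {coin : (id : P.CoinId) → P.CoinVal id}
  {c c' c₀ : Config P} {p : Fin n} {ev : NodeEvent n I P.Msg P.CoinId P.CoinVal} {s : P.State}
  {e : Effects n O P.Msg P.CoinId}

/-- `Consumes coin c p ev c₀`: in the configuration `c` the event `ev` may happen at node `p`, and
`c₀` is what remains of `c` once the event is consumed. This separates the part of an execution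
step that is common to all protocols from the transition of the node. -/
inductive Consumes (coin : (id : P.CoinId) → P.CoinVal id) (c : Config P) (p : Fin n) :
    NodeEvent n I P.Msg P.CoinId P.CoinVal → Config P → Prop where
  | input (v : I) (hin : c.inputs p = none) :
      Consumes coin c p (.input v) { c with inputs := Function.update c.inputs p (some v) }
  | deliver (q : Fin n) (m : P.Msg) (rest : Multiset (Fin n × Fin n × P.Msg))
      (hm : c.net = (q, p, m) ::ₘ rest) : Consumes coin c p (.recv q m) { c with net := rest }
  | forge (q : Fin n) (m : P.Msg) (hq : q ∈ c.corrupted) : Consumes coin c p (.recv q m) c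
  | coin (id : P.CoinId) (rest : Multiset (Fin n × P.CoinId)) (hm : c.pending = (p, id) ::ₘ rest) :
      Consumes coin c p (.coin id (coin id)) { c with pending := rest }
  | tau : Consumes coin c p .tau c

namespace Consumes

theorem state_eq (h : Consumes coin c p ev c₀) : c₀.state = c.state := by cases h <;> rfl

theorem outs_eq (h : Consumes coin c p ev c₀) : c₀.outs = c.outs := by cases h <;> rfl

theorem corrupted_eq (h : Consumes coin c p ev c₀) : c₀.corrupted = c.corrupted := by
  cases h <;> rfl

theorem net_le (h : Consumes coin c p ev c₀) : c₀.net ≤ c.net := by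
  cases h with
  | deliver q m rest hm => exact hm ▸ Multiset.le_cons_self _ _
  | _ => exact le_rfl

theorem inputs_eq_or (h : Consumes coin c p ev c₀) (q : Fin n) :
    c₀.inputs q = c.inputs q ∨ q = p ∧ ∃ v, ev = .input v := by
  cases h with
  | input v hin =>
    by_cases hq : q = p
    · exact .inr ⟨hq, v, rfl⟩
    · exact .inl (by simp [hq])
  | _ => exact .inl rfl

theorem agreesWith (h : Consumes coin c p ev c₀) : ev.AgreesWith coin := by
  cases h <;> simp [NodeEvent.AgreesWith]

theorem delivers (h : Consumes coin c p ev c₀) :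
    ev.Delivers fun q m => q ∈ c.corrupted ∨ (q, p, m) ∈ c.net := by
  cases h with
  | deliver q m rest hm => exact .inr (hm ▸ Multiset.mem_cons_self _ _)
  | forge q m hq => exact .inl hq
  | _ => trivial

end Consumes

namespace Config

theorem mem_net_commit {q r : Fin n} {m : P.Msg} :
    (q, r, m) ∈ (c.commit p s e).net ↔ (q, r, m) ∈ c.net ∨ q = p ∧ (r, m) ∈ e.sends := by
  simp [commit, eq_comm, and_comm]

theorem mem_outs_commit {q : Fin n} {v : O} :
    (q, v) ∈ (c.commit p s e).outs ↔ (q, v) ∈ c.outs ∨ q = p ∧ e.out = some v := by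
  simp [commit, eq_comm, and_comm]

end Config

namespace ExecStep

theorem of_consumes (hp : p ∉ c.corrupted) (hc : Consumes coin c p ev c₀)
    (hs : P.step p (c.state p) ev s e) : ExecStep P t coin c (c₀.commit p s e) := by
  cases hc with
  | input v hin => exact .input c p v s e hp hin hs
  | deliver q m rest hm => exact .deliver c p q m rest s e hp hm hs
  | forge q m hq => exact .forge c p q m s e hp hq hs
  | coin id rest hm => exact .coin c p id rest s e hp hm hs
  | tau => exact .tau c p s e hp hs

theorem consumes_or_corrupt (h : ExecStep P t coin c c') :
    (∃ p ev c₀ s e, p ∉ c.corrupted ∧ Consumes coin c p ev c₀ ∧ P.step p (c.state p) ev s e ∧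
      c' = c₀.commit p s e) ∨
    ∃ p, (insert p c.corrupted).card ≤ t ∧ c' = { c with corrupted := insert p c.corrupted } := by
  cases h with
  | input p v s e hp hin hs => exact .inl ⟨p, _, _, s, e, hp, .input v hin, hs, rfl⟩
  | deliver p q m rest s e hp hm hs => exact .inl ⟨p, _, _, s, e, hp, .deliver q m rest hm, hs, rfl⟩
  | forge p q m s e hp hq hs => exact .inl ⟨p, _, _, s, e, hp, .forge q m hq, hs, rfl⟩
  | coin p id rest s e hp hm hs => exact .inl ⟨p, _, _, s, e, hp, .coin id rest hm, hs, rfl⟩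
  | tau p s e hp hs => exact .inl ⟨p, _, _, s, e, hp, .tau, hs, rfl⟩
  | corrupt p ht => exact .inr ⟨p, ht, rfl⟩

theorem outs_mono (h : ExecStep P t coin c c') {x : Fin n × O} (hx : x ∈ c.outs) : x ∈ c'.outs := by
  obtain ⟨p, ev, c₀, s, e, -, hc, -, rfl⟩ | ⟨p, -, rfl⟩ := h.consumes_or_corrupt
  · exact Config.mem_outs_commit.2 (.inl (hc.outs_eq ▸ hx))
  · exact hx

theorem corrupted_subset (h : ExecStep P t coin c c') : c.corrupted ⊆ c'.corrupted := by
  obtain ⟨p, ev, c₀, s, e, -, hc, -, rfl⟩ | ⟨p, -, rfl⟩ := h.consumes_or_corrupt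
  · exact hc.corrupted_eq.ge
  · exact Finset.subset_insert _ _

end ExecStep

theorem Reachable.card_corrupted_le (h : Reachable P t coin c) : c.corrupted.card ≤ t := by
  induction h with
  | refl => simp [Config.start]
  | tail _ hs ih =>
    obtain ⟨p, ev, c₀, s, e, -, hc, -, rfl⟩ | ⟨p, ht, rfl⟩ := hs.consumes_or_corrupt
    · exact hc.corrupted_eq ▸ ih
    · exact ht

end Executions

/-- An invariant of a protocol, stated in terms of what the nodes have said so far. The log of a
node, of type `L`, is not part of its state: it is what an observer remembers of its public
commitments. States may depend on the logs of all nodes, but once established the conditions must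
survive the growth of the logs of other nodes. -/
structure LogInvariant {n : ℕ} {I O : Type} (P : Protocol n I O) (L : Type*) [Preorder L] where
  StateOk : (Fin n → L) → Fin n → P.State → Prop
  /-- condition on a message with given sender and receiver -/
  MsgOk : (Fin n → L) → Fin n → Fin n → P.Msg → Prop
  OutOk : (Fin n → L) → O → Prop
  stateOk_mono : ∀ {X Y : Fin n → L} {p : Fin n} {s : P.State},
    X ≤ Y → X p = Y p → StateOk X p s → StateOk Y p s
  msgOk_mono : ∀ {X Y : Fin n → L} {p q : Fin n} {m : P.Msg}, X ≤ Y → MsgOk X p q m → MsgOk Y p q m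
  outOk_mono : ∀ {X Y : Fin n → L} {v : O}, X ≤ Y → OutOk X v → OutOk Y v

namespace LogInvariant

variable {n : ℕ} {I O : Type} {P : Protocol n I O} {L : Type*} [Preorder L]

/-- With the logs `X`, the invariant is satisfied in the configuration `c` by all the nodes outside
`F`, by the messages they have sent and by the values they have output. -/
structure Holds (J : LogInvariant P L) (F : Finset (Fin n)) (X : Fin n → L) (c : Config P) :
    Prop where
  state : ∀ p ∉ F, J.StateOk X p (c.state p)
  net : ∀ p q m, p ∉ F → (p, q, m) ∈ c.net → J.MsgOk X p q m
  outs : ∀ p v, p ∉ F → (p, v) ∈ c.outs → J.OutOk X v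

/-- If the logs were `X`, then node `p` may move to the state `s` with the effects `e`, upon which
its log becomes `x`, without violating the invariant. -/
structure Maintains (J : LogInvariant P L) (X : Fin n → L) (p : Fin n) (s : P.State)
    (e : Effects n O P.Msg P.CoinId) (x : L) : Prop where
  le : X p ≤ x
  state : J.StateOk (Function.update X p x) p s
  sends : ∀ q m, (q, m) ∈ e.sends → J.MsgOk (Function.update X p x) p q m
  out : ∀ v, e.out = some v → J.OutOk (Function.update X p x) v

variable {J : LogInvariant P L} {F : Finset (Fin n)} {X : Fin n → L} {c c₀ : Config P} {p : Fin n}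
  {s : P.State} {e : Effects n O P.Msg P.CoinId} {x : L}

theorem Holds.commit (h : J.Holds F X c₀) (hm : J.Maintains X p s e x) :
    J.Holds F (Function.update X p x) (c₀.commit p s e) := by
  have hle : X ≤ Function.update X p x := le_update_self_iff.2 hm.le
  refine ⟨fun q hq => ?_, fun q r m hq hmem => ?_, fun q v hq hmem => ?_⟩
  · by_cases hqp : q = p
    · subst hqp
      simpa [Config.commit] using hm.state
    · have := J.stateOk_mono hle (by simp [hqp]) (h.state q hq)
      simpa [Config.commit, hqp] using this
  · obtain hold | ⟨rfl, hnew⟩ := Config.mem_net_commit.1 hmem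
    · exact J.msgOk_mono hle (h.net q r m hq hold)
    · exact hm.sends r m hnew
  · obtain hold | ⟨rfl, hnew⟩ := Config.mem_outs_commit.1 hmem
    · exact J.outOk_mono hle (h.outs q v hq hold)
    · exact hm.out v hnew

theorem Holds.of_consumes {coin : (id : P.CoinId) → P.CoinVal id}
    {ev : NodeEvent n I P.Msg P.CoinId P.CoinVal} (h : J.Holds F X c)
    (hc : Consumes coin c p ev c₀) : J.Holds F X c₀ where
  state := hc.state_eq ▸ h.state
  net q r m hq hmem := h.net q r m hq (Multiset.mem_of_le hc.net_le hmem)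
  outs := hc.outs_eq ▸ h.outs

theorem Holds.commit_of_mem (h : J.Holds F X c₀) (hp : p ∈ F) :
    J.Holds F X (c₀.commit p s e) := by
  refine ⟨fun q hq => ?_, fun q r m hq hmem => ?_, fun q v hq hmem => ?_⟩
  · have hqp : q ≠ p := ne_of_mem_of_not_mem hp hq |>.symm
    simpa [Config.commit, hqp] using h.state q hq
  · obtain hold | ⟨rfl, -⟩ := Config.mem_net_commit.1 hmem
    · exact h.net q r m hq hold
    · exact absurd hp hq
  · obtain hold | ⟨rfl, -⟩ := Config.mem_outs_commit.1 hmem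
    · exact h.outs q v hq hold
    · exact absurd hp hq

theorem exists_holds (J : LogInvariant P L) {t : ℕ} {coin : (id : P.CoinId) → P.CoinVal id}
    {X₀ : Fin n → L} (init : ∀ p, J.StateOk X₀ p P.init)
    (step : ∀ {X p s ev s' e}, p ∉ F → P.step p s ev s' e → ev.AgreesWith coin →
      ev.Delivers (fun q m => q ∉ F → J.MsgOk X q p m) → J.StateOk X p s →
      ∃ x, J.Maintains X p s' e x)
    (h : Reachable P t coin c) (hF : c.corrupted ⊆ F) : ∃ X, J.Holds F X c := by
  induction h with
  | refl => exact ⟨X₀, fun p _ => init p, by simp [Config.start], by simp [Config.start]⟩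
  | @tail c c' _ hs ih =>
    have hcF : c.corrupted ⊆ F := hs.corrupted_subset.trans hF
    obtain ⟨X, hX⟩ := ih hcF
    obtain ⟨p, ev, c₀, s, e, -, hc, hst, rfl⟩ | ⟨p, -, rfl⟩ := hs.consumes_or_corrupt
    · by_cases hp : p ∈ F
      · exact ⟨X, (hX.of_consumes hc).commit_of_mem hp⟩
      · have hrecv : ev.Delivers fun q m => q ∉ F → J.MsgOk X q p m :=
          hc.delivers.imp fun q m hm hq => hX.net q p m hq (hm.resolve_left fun h => hq (hcF h))
        obtain ⟨x, hx⟩ := step hp hst hc.agreesWith hrecv (hX.state p hp)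
        exact ⟨_, (hX.of_consumes hc).commit hx⟩
    · exact ⟨X, hX.state, hX.net, hX.outs⟩

end LogInvariant

/-! ## Executions of subprotocols -/

/-- A way to find an instance of the protocol `Q` in the protocol `P`: which messages and coins
belong to the instance, and its local state, whether it has received its input, and its output. -/
structure Subprotocol {n : ℕ} {I O I' O' : Type} (P : Protocol n I O) (Q : Protocol n I' O') where
  msg : P.Msg → Option Q.Msg
  coinId : P.CoinId → Option Q.CoinId
  state : P.State → Q.State
  started : P.State → Prop
  out : P.State → Option O'

namespace Subprotocol

variable {n : ℕ} {I O I' O' : Type} {P : Protocol n I O} {Q : Protocol n I' O'}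
  (E : Subprotocol P Q)

/-- The messages of the instance in a list of messages to send. -/
def sends (l : List (Fin n × P.Msg)) : List (Fin n × Q.Msg) :=
  l.filterMap fun x => (E.msg x.2).map fun m => (x.1, m)

/-- The messages of the instance in transit. -/
def net (N : Multiset (Fin n × Fin n × P.Msg)) : Multiset (Fin n × Fin n × Q.Msg) :=
  N.filterMap fun x => (E.msg x.2.2).map fun m => (x.1, x.2.1, m)

/-- The coins of the instance that have not been returned yet. -/
def pending (N : Multiset (Fin n × P.CoinId)) : Multiset (Fin n × Q.CoinId) :=
  N.filterMap fun x => (E.coinId x.2).map fun id => (x.1, id)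

/-- The event does not concern the instance. -/
def Foreign : NodeEvent n I P.Msg P.CoinId P.CoinVal → Prop
  | .recv _ m => E.msg m = none
  | .coin id _ => E.coinId id = none
  | _ => True

/-- The step does not concern the instance. -/
structure Idle (s : P.State) (ev : NodeEvent n I P.Msg P.CoinId P.CoinVal) (s' : P.State)
    (e : Effects n O P.Msg P.CoinId) : Prop where
  foreign : E.Foreign ev
  state_eq : E.state s' = E.state s
  out_eq : E.out s' = E.out s
  started : E.started s → E.started s'
  sends_eq : E.sends e.sends = []
  toss_eq : e.toss.filterMap E.coinId = []

/-- The event of the instance that corresponds to an event at the node; `fresh` says that the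
instance has not received its input. -/
inductive Corresponds (coin : (id : Q.CoinId) → Q.CoinVal id) (fresh : Prop) :
    NodeEvent n I P.Msg P.CoinId P.CoinVal → NodeEvent n I' Q.Msg Q.CoinId Q.CoinVal → Prop where
  | input (v : I') (h : fresh) : Corresponds coin fresh .tau (.input v)
  | recv (j : Fin n) (m : P.Msg) (m' : Q.Msg) (h : E.msg m = some m') :
      Corresponds coin fresh (.recv j m) (.recv j m')
  | coin (id : P.CoinId) (v : P.CoinVal id) (id' : Q.CoinId) (h : E.coinId id = some id') :
      Corresponds coin fresh (.coin id v) (.coin id' (coin id'))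
  | tau : Corresponds coin fresh .tau .tau

/-- The step is a step of the instance at node `p`, where `ev'` and `e'` are the event and the
effects that the instance sees. -/
structure Active (coin : (id : Q.CoinId) → Q.CoinVal id) (p : Fin n) (s : P.State)
    (ev : NodeEvent n I P.Msg P.CoinId P.CoinVal) (s' : P.State) (e : Effects n O P.Msg P.CoinId)
    (ev' : NodeEvent n I' Q.Msg Q.CoinId Q.CoinVal) (e' : Effects n O' Q.Msg Q.CoinId) : Prop where
  corresponds : E.Corresponds coin (¬ E.started s) ev ev'
  step : Q.step p (E.state s) ev' (E.state s') e'
  out_eq : E.out s' = e'.out.or (E.out s)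
  started : E.started s → E.started s'
  started_of_input : ∀ v, ev' = .input v → E.started s'
  sends_eq : E.sends e.sends = e'.sends
  toss_eq : e.toss.filterMap E.coinId = e'.toss

/-- With respect to the coins `coin` of the protocol and `coin'` of the instance, every step of a
node is either a step of the instance or does not concern it. -/
structure Embedded (coin : (id : P.CoinId) → P.CoinVal id)
    (coin' : (id : Q.CoinId) → Q.CoinVal id) : Prop where
  state_init : E.state P.init = Q.init
  out_init : E.out P.init = none
  step : ∀ {p s ev s' e}, P.step p s ev s' e → ev.AgreesWith coin →
    E.Idle s ev s' e ∨ ∃ ev' e', E.Active coin' p s ev s' e ev' e'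

/-- The configuration `d` of `Q` is what one sees of the instance in the configuration `c`. -/
structure View (c : Config P) (d : Config Q) : Prop where
  state_eq : ∀ p, d.state p = E.state (c.state p)
  net_eq : d.net = E.net c.net
  pending_eq : d.pending = E.pending c.pending
  corrupted_eq : d.corrupted = c.corrupted
  outs : ∀ p v, E.out (c.state p) = some v → (p, v) ∈ d.outs

/-- In the configuration `d` of `Q`, no node has received an input that it has not received for the
instance in the configuration `c`. -/
def Fresh (c : Config P) (d : Config Q) : Prop :=
  ∀ p, ¬ E.started (c.state p) → d.inputs p = none

variable {E} {coin : (id : P.CoinId) → P.CoinVal id} {coin' : (id : Q.CoinId) → Q.CoinVal id}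
  {t : ℕ} {c c' c₀ : Config P} {d d₀ : Config Q} {p : Fin n}
  {ev : NodeEvent n I P.Msg P.CoinId P.CoinVal} {s : P.State} {e : Effects n O P.Msg P.CoinId}
  {ev' : NodeEvent n I' Q.Msg Q.CoinId Q.CoinVal} {s' : Q.State}
  {e' : Effects n O' Q.Msg Q.CoinId}

theorem sends_map_of_eq_none {α : Type} (f : α → Fin n × P.Msg) (h : ∀ a, E.msg (f a).2 = none)
    (l : List α) : E.sends (l.map f) = [] := by
  simp [sends, h, List.filterMap_map]

theorem sends_map_self (g : Q.Msg → P.Msg) (h : ∀ m, E.msg (g m) = some m)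
    (l : List (Fin n × Q.Msg)) : E.sends (l.map fun x => (x.1, g x.2)) = l := by
  simp [sends, h, List.filterMap_map]

theorem toss_map_of_eq_none {α : Type} (f : α → P.CoinId) (h : ∀ a, E.coinId (f a) = none)
    (l : List α) : (l.map f).filterMap E.coinId = [] := by
  simp [h, List.filterMap_map]

theorem toss_map_self (g : Q.CoinId → P.CoinId) (h : ∀ id, E.coinId (g id) = some id)
    (l : List Q.CoinId) : (l.map g).filterMap E.coinId = l := by
  simp [h, List.filterMap_map]

theorem net_add (N : Multiset (Fin n × Fin n × P.Msg)) (p : Fin n) (l : List (Fin n × P.Msg)) :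
    E.net (N + Multiset.ofList (l.map fun x => (p, x.1, x.2))) =
      E.net N + Multiset.ofList ((E.sends l).map fun x => (p, x.1, x.2)) := by
  simp only [net, sends, Multiset.filterMap_add, Multiset.filterMap_coe, List.filterMap_map,
    List.map_filterMap]
  congr 3
  funext x
  simp [Function.comp_def]

theorem pending_add (N : Multiset (Fin n × P.CoinId)) (p : Fin n) (l : List P.CoinId) :
    E.pending (N + Multiset.ofList (l.map fun id => (p, id))) =
      E.pending N + Multiset.ofList ((l.filterMap E.coinId).map fun id => (p, id)) := by
  simp only [pending, Multiset.filterMap_add, Multiset.filterMap_coe, List.filterMap_map,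
    List.map_filterMap]
  congr 3

theorem Embedded.view_start (hE : E.Embedded coin coin') :
    E.View (Config.start P) (Config.start Q) where
  state_eq _ := hE.state_init.symm
  net_eq := rfl
  pending_eq := rfl
  corrupted_eq := rfl
  outs p v h := by simp [Config.start, hE.out_init] at h

theorem View.commit (hv : E.View c₀ d₀) (hs : E.state s = s') (hsends : E.sends e.sends = e'.sends)
    (htoss : e.toss.filterMap E.coinId = e'.toss)
    (hout : E.out s = e'.out.or (E.out (c₀.state p))) :
    E.View (c₀.commit p s e) (d₀.commit p s' e') where
  state_eq q := by
    by_cases hq : q = p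
    · subst hq; simp [Config.commit, hs]
    · simp [Config.commit, hq, hv.state_eq]
  net_eq := by simp only [Config.commit, net_add, hsends, hv.net_eq]
  pending_eq := by simp only [Config.commit, pending_add, htoss, hv.pending_eq]
  corrupted_eq := hv.corrupted_eq
  outs q v hq := by
    rw [Config.mem_outs_commit]
    by_cases hqp : q = p
    · subst hqp
      have hq : E.out s = some v := by simpa [Config.commit] using hq
      rw [hout, Option.or_eq_some_iff] at hq
      obtain hq | ⟨-, hq⟩ := hq
      · exact .inr ⟨rfl, hq⟩
      · exact .inl (hv.outs _ _ hq)
    · exact .inl (hv.outs _ _ (by simpa [Config.commit, hqp] using hq))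

theorem View.of_foreign (hv : E.View c d) (hc : Consumes coin c p ev c₀) (hev : E.Foreign ev) :
    E.View c₀ d where
  state_eq := hc.state_eq ▸ hv.state_eq
  net_eq := by
    rw [hv.net_eq]
    cases hc with
    | deliver q m rest hm => simp [net, hm, show E.msg m = none from hev]
    | _ => rfl
  pending_eq := by
    rw [hv.pending_eq]
    cases hc with
    | coin id rest hm => simp [pending, hm, show E.coinId id = none from hev]
    | _ => rfl
  corrupted_eq := hv.corrupted_eq.trans hc.corrupted_eq.symm
  outs := hc.state_eq ▸ hv.outs

theorem View.idle (hv : E.View c d) (hc : Consumes coin c p ev c₀)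
    (h : E.Idle (c.state p) ev s e) : E.View (c₀.commit p s e) d := by
  have hd : d.commit p (d.state p) {} = d := by simp [Config.commit]
  rw [← hd]
  exact (hv.of_foreign hc h.foreign).commit (h.state_eq.trans (hv.state_eq p).symm) h.sends_eq
    h.toss_eq (by rw [h.out_eq, hc.state_eq]; rfl)

theorem View.exists_consumes (hv : E.View c d) (hf : E.Fresh c d) (hc : Consumes coin c p ev c₀)
    (h : E.Corresponds coin' (¬ E.started (c.state p)) ev ev') :
    ∃ d₀, Consumes coin' d p ev' d₀ ∧ E.View c₀ d₀ := by
  cases h with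
  | input v hs =>
    cases hc
    exact ⟨_, .input v (hf p hs), hv.state_eq, hv.net_eq, hv.pending_eq, hv.corrupted_eq, hv.outs⟩
  | recv j m m' hm' =>
    cases hc with
    | deliver q m rest hm =>
      have hnet : d.net = (j, p, m') ::ₘ E.net rest := by
        rw [hv.net_eq, hm, net, Multiset.filterMap_cons_some (b := (j, p, m')) _ _ _
          (by simp [hm'])]
        rfl
      exact ⟨_, .deliver j m' _ hnet, hv.state_eq, rfl, hv.pending_eq, hv.corrupted_eq, hv.outs⟩
    | forge q m hq => exact ⟨d, .forge j m' (hv.corrupted_eq ▸ hq), hv⟩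
  | coin id v id' hid =>
    cases hc with
    | coin id rest hm =>
      have hpending : d.pending = (p, id') ::ₘ E.pending rest := by
        rw [hv.pending_eq, hm, pending, Multiset.filterMap_cons_some (b := (p, id')) _ _ _
          (by simp [hid])]
        rfl
      exact ⟨_, .coin id' _ hpending, hv.state_eq, hv.net_eq, rfl, hv.corrupted_eq, hv.outs⟩
  | tau =>
    cases hc
    exact ⟨d, .tau, hv⟩

theorem Fresh.commit (hf : E.Fresh c d) (hc : Consumes coin c p ev c₀)
    (hstarted : E.started (c.state p) → E.started s)
    (hinputs : ∀ q, ¬ (q = p ∧ E.started s) → d₀.inputs q = d.inputs q) :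
    E.Fresh (c₀.commit p s e) (d₀.commit p s' e') := by
  intro q hq
  have hq' : ¬ E.started (Function.update c.state p s q) := by
    simpa [Config.commit, hc.state_eq] using hq
  by_cases hqp : q = p
  · subst hqp
    rw [Function.update_self] at hq'
    exact (hinputs q fun h => hq' h.2).trans (hf q fun h => hq' (hstarted h))
  · rw [Function.update_of_ne hqp] at hq'
    exact (hinputs q fun h => hqp h.1).trans (hf q hq')

theorem Embedded.exists_execStep (hE : E.Embedded coin coin') (hv : E.View c d) (hf : E.Fresh c d)
    (h : ExecStep P t coin c c') :
    ∃ d', (d' = d ∨ ExecStep Q t coin' d d') ∧ E.View c' d' ∧ E.Fresh c' d' := by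
  obtain ⟨p, ev, c₀, s, e, hp, hc, hs, rfl⟩ | ⟨p, ht, rfl⟩ := h.consumes_or_corrupt
  · obtain hi | ⟨ev', e', ha⟩ := hE.step hs hc.agreesWith
    · exact ⟨d, .inl rfl, hv.idle hc hi,
        hf.commit (s' := d.state p) (e' := {}) hc hi.started fun _ _ => rfl⟩
    · obtain ⟨d₀, hd, hv₀⟩ := hv.exists_consumes hf hc ha.corresponds
      refine ⟨d₀.commit p (E.state s) e', .inr (.of_consumes (hv.corrupted_eq ▸ hp) hd
        (hv.state_eq p ▸ ha.step)), hv₀.commit rfl ha.sends_eq ha.toss_eq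
        (hc.state_eq ▸ ha.out_eq), hf.commit hc ha.started fun q hq => ?_⟩
      obtain h' | ⟨rfl, v, h'⟩ := hd.inputs_eq_or q
      · exact h'
      · exact absurd ⟨rfl, ha.started_of_input v h'⟩ hq
  · exact ⟨{ d with corrupted := insert p d.corrupted }, .inr (.corrupt d p (hv.corrupted_eq ▸ ht)),
      ⟨hv.state_eq, hv.net_eq, hv.pending_eq, congrArg (insert p) hv.corrupted_eq, hv.outs⟩, hf⟩

end Subprotocol

/-- What node `p` has output in the executions of a family of protocols with configurations `D`. -/
def outsAt {n : ℕ} {I O : Type} {Q : Protocol n I O} {ι : Type*} (D : ι → Config Q) (p : Fin n)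
    (i : ι) : Set O :=
  {v | (p, v) ∈ (D i).outs}

/-- Through `StateOk` and `OutOk`, invariants of the calling protocol may refer to the outputs that
the subprotocols have had at the same node. -/
theorem Reachable.exists_instances {n : ℕ} {I O I' O' : Type} {P : Protocol n I O}
    {Q : Protocol n I' O'} {ι : Type*} {E : ι → Subprotocol P Q} {t : ℕ}
    {coin : (id : P.CoinId) → P.CoinVal id} {coin' : ι → (id : Q.CoinId) → Q.CoinVal id}
    (hE : ∀ i, (E i).Embedded coin (coin' i)) {StateOk : (ι → Set O') → P.State → Prop}
    {OutOk : (ι → Set O') → O → Prop}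
    (stateOk_mono : ∀ {X Y s}, X ≤ Y → StateOk X s → StateOk Y s)
    (outOk_mono : ∀ {X Y v}, X ≤ Y → OutOk X v → OutOk Y v)
    (init : ∀ X, StateOk X P.init)
    (step : ∀ {X p s ev s' e}, P.step p s ev s' e → ev.AgreesWith coin →
      (∀ i o, (E i).out s = some o → o ∈ X i) → StateOk X s →
      StateOk X s' ∧ ∀ v, e.out = some v → OutOk X v)
    {c : Config P} (h : Reachable P t coin c) :
    ∃ D : ι → Config Q, (∀ i, Reachable Q t (coin' i) (D i)) ∧
      (∀ i, (D i).corrupted = c.corrupted) ∧ (∀ p, StateOk (outsAt D p) (c.state p)) ∧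
      ∀ p v, (p, v) ∈ c.outs → OutOk (outsAt D p) v := by
  suffices ∃ D : ι → Config Q, (∀ i, Reachable Q t (coin' i) (D i)) ∧
      (∀ i, (E i).View c (D i) ∧ (E i).Fresh c (D i)) ∧
      (∀ p, StateOk (outsAt D p) (c.state p)) ∧
      ∀ p v, (p, v) ∈ c.outs → OutOk (outsAt D p) v by
    obtain ⟨D, hD, hv, hstate, hout⟩ := this
    exact ⟨D, hD, fun i => (hv i).1.corrupted_eq, hstate, hout⟩
  induction h with
  | refl =>
    exact ⟨fun _ => Config.start Q, fun _ => .refl, fun i => ⟨(hE i).view_start, fun _ _ => rfl⟩,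
      fun _ => init _, fun _ _ hv => by simp [Config.start] at hv⟩
  | @tail c c' _ hs ih =>
    obtain ⟨D, hD, hv, hstate, hout⟩ := ih
    choose D' hD' hv' hf' using fun i => (hE i).exists_execStep (hv i).1 (hv i).2 hs
    have hle (p) : outsAt D p ≤ outsAt D' p := fun i v (hmem : (p, v) ∈ (D i).outs) =>
      show (p, v) ∈ (D' i).outs from (hD' i).elim (fun h => h ▸ hmem) fun h => h.outs_mono hmem
    refine ⟨D', fun i => (hD' i).elim (fun h => h.symm ▸ hD i) (hD i).tail,
      fun i => ⟨hv' i, hf' i⟩, ?_⟩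
    obtain ⟨p, ev, c₀, s, e, -, hc, hst, rfl⟩ | ⟨p, -, rfl⟩ := hs.consumes_or_corrupt
    · have hstep := step hst hc.agreesWith (fun i o ho => hle p i ((hv i).1.outs p o ho))
        (stateOk_mono (hle p) (hstate p))
      refine ⟨fun q => ?_, fun q v hmem => ?_⟩
      · by_cases hqp : q = p
        · subst hqp; simpa [Config.commit] using hstep.1
        · simpa [Config.commit, hqp, hc.state_eq] using stateOk_mono (hle q) (hstate q)
      · obtain hold | ⟨rfl, hnew⟩ := Config.mem_outs_commit.1 hmem
        · exact outOk_mono (hle q) (hout q v (hc.outs_eq ▸ hold))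
        · exact hstep.2 v hnew
    · exact ⟨fun q => stateOk_mono (hle q) (hstate q), fun q v h => outOk_mono (hle q) (hout q v h)⟩

/-! ## Counting nodes -/

section Counting

variable {n : ℕ} {P Q : Fin n → Prop} {F : Finset (Fin n)}

theorem nodeCount_eq_card_filter (P : Fin n → Prop) [DecidablePred P] :
    nodeCount P = (Finset.univ.filter P).card := by
  unfold nodeCount
  congr

theorem nodeCount_mono (h : ∀ j, P j → Q j) : nodeCount P ≤ nodeCount Q := by
  classical
  rw [nodeCount_eq_card_filter, nodeCount_eq_card_filter]
  exact Finset.card_le_card (Finset.monotone_filter_right _ fun j _ => h j)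

theorem nodeCount_le_nodeCount_notMem_add_card (P : Fin n → Prop) (F : Finset (Fin n)) :
    nodeCount P ≤ nodeCount (fun j => j ∉ F ∧ P j) + F.card := by
  classical
  rw [nodeCount_eq_card_filter, nodeCount_eq_card_filter]
  refine (Finset.card_le_card fun j hj => ?_).trans (Finset.card_union_le _ _)
  by_cases h : j ∈ F <;> simp_all

theorem card_compl_sub_le_nodeCount_notMem {r : ℕ} (F : Finset (Fin n))
    (h : n - r ≤ nodeCount P) : Fᶜ.card - r ≤ nodeCount fun j => j ∉ F ∧ P j := by
  have hP := nodeCount_le_nodeCount_notMem_add_card P F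
  have hF := Finset.card_compl_add_card F
  rw [Fintype.card_fin] at hF
  omega

theorem nodeCount_notMem_and [DecidablePred P] :
    nodeCount (fun j => j ∉ F ∧ P j) = (Fᶜ.filter P).card := by
  rw [nodeCount_eq_card_filter]
  congr 1
  ext j
  simp

theorem exists_notMem_of_card_lt_nodeCount (h : F.card < nodeCount P) : ∃ j, j ∉ F ∧ P j := by
  classical
  rw [nodeCount_eq_card_filter] at h
  obtain ⟨j, hj, hF⟩ := Finset.exists_mem_notMem_of_card_lt_card h
  exact ⟨j, hF, (Finset.mem_filter.1 hj).2⟩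

end Counting

/-! ## Agreement of the binary agreement -/

namespace ABBA

variable {n t : ℕ} {coin : ℕ → Bool} {F : Finset (Fin n)} {X Y : Fin n → Set (ℕ × Bool)}
  {r : ℕ} {b : Bool} {V : Finset Bool} {p : Fin n} {s s' : State n} {ev : Ev n} {e : Eff n}

/-- There are `n - t` nodes such that those of them outside `F` have sent an `aux` message with a
value in `V` in the round `r`. Here and below, `(r, b) ∈ X j` says that node `j` has sent
`aux r b`. -/
def Quorum (t : ℕ) (F : Finset (Fin n)) (X : Fin n → Set (ℕ × Bool)) (r : ℕ) (V : Finset Bool) :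
    Prop :=
  ∃ Q : Finset (Fin n), n - t ≤ Q.card ∧ ∀ j ∈ Q, j ∉ F → ∃ b ∈ V, (r, b) ∈ X j

/-- The values that a node outside `F` may have as its estimate at the beginning of a round. -/
inductive Estimate (t : ℕ) (coin : ℕ → Bool) (F : Finset (Fin n)) (X : Fin n → Set (ℕ × Bool)) :
    ℕ → Bool → Prop where
  | zero (b : Bool) : Estimate t coin F X 0 b
  | majority {r : ℕ} {b : Bool} (hq : Quorum t F X r {b}) (h : Estimate t coin F X r b) :
      Estimate t coin F X (r + 1) b
  | coin {r : ℕ} (h : ∀ b, Estimate t coin F X r b) : Estimate t coin F X (r + 1) (coin r)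

/-- The sets of values that a node outside `F` may collect in the round `r`. -/
def Collected (t : ℕ) (coin : ℕ → Bool) (F : Finset (Fin n)) (X : Fin n → Set (ℕ × Bool)) (r : ℕ)
    (V : Finset Bool) : Prop :=
  Quorum t F X r V ∧ ∀ b ∈ V, Estimate t coin F X r b

/-- In some round a node outside `F` may have collected the value `b` only, and the coin shows `b`:
the reason to send the first `finish b`. -/
def Hit (t : ℕ) (coin : ℕ → Bool) (F : Finset (Fin n)) (X : Fin n → Set (ℕ × Bool)) (b : Bool) :
    Prop :=
  ∃ r, Collected t coin F X r {b} ∧ coin r = b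

theorem Quorum.mono (hXY : X ≤ Y) (h : Quorum t F X r V) : Quorum t F Y r V :=
  let ⟨Q, hQ, hV⟩ := h
  ⟨Q, hQ, fun j hj hjF => let ⟨b, hb, hbX⟩ := hV j hj hjF; ⟨b, hb, hXY j hbX⟩⟩

theorem Estimate.mono (hXY : X ≤ Y) (h : Estimate t coin F X r b) : Estimate t coin F Y r b := by
  induction h with
  | zero b => exact .zero b
  | majority hq _ ih => exact .majority (hq.mono hXY) ih
  | coin _ ih => exact .coin ih

theorem Collected.mono (hXY : X ≤ Y) (h : Collected t coin F X r V) : Collected t coin F Y r V :=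
  ⟨h.1.mono hXY, fun b hb => (h.2 b hb).mono hXY⟩

theorem Hit.mono (hXY : X ≤ Y) (h : Hit t coin F X b) : Hit t coin F Y b :=
  let ⟨r, hc, hr⟩ := h
  ⟨r, hc.mono hXY, hr⟩

/-- No node outside `F` has sent `aux` messages with different values in a round. -/
def UniqueVotes (F : Finset (Fin n)) (X : Fin n → Set (ℕ × Bool)) : Prop :=
  ∀ j ∉ F, ∀ r b b', (r, b) ∈ X j → (r, b') ∈ X j → b = b'

theorem Quorum.eq_of_singleton (hn : 3 * t + 1 ≤ n) (hF : F.card ≤ t) (hX : UniqueVotes F X)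
    {b' : Bool} (h : Quorum t F X r {b}) (h' : Quorum t F X r {b'}) : b = b' := by
  obtain ⟨Q, hQ, hb⟩ := h
  obtain ⟨Q', hQ', hb'⟩ := h'
  have hunion : (Q ∪ Q').card ≤ n := by simpa using Finset.card_le_univ (Q ∪ Q')
  have hinter := Finset.card_union_add_card_inter Q Q'
  obtain ⟨j, hj, hjF⟩ := Finset.exists_mem_notMem_of_card_lt_card (s := F) (t := Q ∩ Q') (by omega)
  simp only [Finset.mem_inter, Finset.mem_singleton, exists_eq_left] at hj hb hb'
  exact hX j hjF _ _ _ (hb j hj.1 hjF) (hb' j hj.2 hjF)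

theorem Estimate.eq_of_hit (hn : 3 * t + 1 ≤ n) (hF : F.card ≤ t) (hX : UniqueVotes F X)
    (hq : Quorum t F X r {b}) (hr : coin r = b) {r' : ℕ} (hlt : r < r') :
    ∀ {b'}, Estimate t coin F X r' b' → b' = b := by
  induction r', hlt using Nat.le_induction with
  | base =>
    rintro _ (_ | ⟨hq', -⟩ | -)
    · exact hq'.eq_of_singleton hn hF hX hq
    · exact hr
  | succ r' _ ih =>
    rintro _ (_ | ⟨-, h⟩ | h)
    · exact ih h
    · exact absurd (ih (h (!b))) (by simp)

theorem Hit.unique (hn : 3 * t + 1 ≤ n) (hF : F.card ≤ t) (hX : UniqueVotes F X) {b' : Bool}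
    (h : Hit t coin F X b) (h' : Hit t coin F X b') : b = b' := by
  obtain ⟨r, hc, hr⟩ := h
  obtain ⟨r', hc', hr'⟩ := h'
  obtain hlt | rfl | hlt := lt_trichotomy r r'
  · exact ((hc'.2 b' (by simp)).eq_of_hit hn hF hX hc.1 hr hlt).symm
  · exact hr.symm.trans hr'
  · exact (hc.2 b (by simp)).eq_of_hit hn hF hX hc'.1 hr' hlt

theorem Quorum.nonempty (hn : 2 * t < n) (hF : F.card ≤ t) (h : Quorum t F X r V) :
    V.Nonempty := by
  obtain ⟨Q, hQ, hV⟩ := h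
  obtain ⟨j, hj, hjF⟩ := Finset.exists_mem_notMem_of_card_lt_card (s := F) (t := Q) (by omega)
  obtain ⟨b, hb, -⟩ := hV j hj hjF
  exact ⟨b, hb⟩

theorem Collected.estimate_coin (hn : 2 * t < n) (hF : F.card ≤ t)
    (h : Collected t coin F X r V) (hV : ∀ b, V ≠ {b}) : Estimate t coin F X (r + 1) (coin r) := by
  have hmem : ∀ V : Finset Bool, V.Nonempty → (∀ b, V ≠ {b}) → ∀ b, b ∈ V := by decide
  exact .coin fun b => h.2 b (hmem V (h.1.nonempty hn hF) hV b)

theorem Collected.estimate_singleton (h : Collected t coin F X r {b}) :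
    Estimate t coin F X (r + 1) b :=
  .majority h.1 (h.2 b (Finset.mem_singleton_self b))

/-- The condition on messages of nodes outside `F`. -/
def MsgOk (t : ℕ) (coin : ℕ → Bool) (F : Finset (Fin n)) (X : Fin n → Set (ℕ × Bool))
    (p : Fin n) : Msg → Prop
  | .bval r b => Estimate t coin F X r b
  | .aux r b => (r, b) ∈ X p
  | .finish b => Hit t coin F X b

/-- The condition on what a node outside `F` has received from other nodes outside `F`, and on what
it has concluded from that. -/
structure Received (t : ℕ) (coin : ℕ → Bool) (F : Finset (Fin n)) (X : Fin n → Set (ℕ × Bool))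
    (s : State n) : Prop where
  bvalRecv : ∀ r b j, (r, b, j) ∈ s.bvalRecv → j ∉ F → Estimate t coin F X r b
  auxRecv : ∀ r b j, (r, b, j) ∈ s.auxRecv → j ∉ F → (r, b) ∈ X j
  finishRecv : ∀ b j, (b, j) ∈ s.finishRecv → j ∉ F → Hit t coin F X b
  binVals : ∀ r b, (r, b) ∈ s.binVals → Estimate t coin F X r b
  vals : ∀ V, s.vals = some V → ∃ r est, s.cur = some (r, est) ∧ Collected t coin F X r V

/-- The condition on the set `x` of the `aux` messages that a node has sent. -/
structure VotesOk (x : Set (ℕ × Bool)) (s : State n) : Prop where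
  mem_auxSent : ∀ r b, (r, b) ∈ x → r ∈ s.auxSent
  unique : ∀ r b b', (r, b) ∈ x → (r, b') ∈ x → b = b'

/-- The `aux` messages among the effects of a step. -/
def votes (e : Eff n) : Set (ℕ × Bool) :=
  {v | ∃ q, (q, Msg.aux v.1 v.2) ∈ e.sends}

theorem MsgOk.mono (hXY : X ≤ Y) {m : Msg} (h : MsgOk t coin F X p m) : MsgOk t coin F Y p m := by
  cases m with
  | bval r b => exact Estimate.mono hXY h
  | aux r b => exact hXY p h
  | finish b => exact Hit.mono hXY h

theorem Received.mono (hXY : X ≤ Y) (h : Received t coin F X s) : Received t coin F Y s where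
  bvalRecv r b j hm hj := (h.bvalRecv r b j hm hj).mono hXY
  auxRecv r b j hm hj := hXY j (h.auxRecv r b j hm hj)
  finishRecv b j hm hj := (h.finishRecv b j hm hj).mono hXY
  binVals r b hb := (h.binVals r b hb).mono hXY
  vals V hV := let ⟨r, est, hc, hcol⟩ := h.vals V hV; ⟨r, est, hc, hcol.mono hXY⟩

theorem Received.collected (h : Received t coin F X s) {est : Bool} (hc : s.cur = some (r, est))
    (hV : s.vals = some V) : Collected t coin F X r V := by
  obtain ⟨r', est', hc', hcol⟩ := h.vals V hV
  obtain ⟨rfl, rfl⟩ : r = r' ∧ est = est' := by simpa [hc] using hc'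
  exact hcol

theorem Step.votes_subset (h : Step n t s ev s' e) :
    votes e = ∅ ∧ s'.auxSent = s.auxSent ∨
    ∃ r b, r ∉ s.auxSent ∧ votes e ⊆ {(r, b)} ∧ s'.auxSent = insert r s.auxSent := by
  cases h with
  | sendAux r est b h hc hb hs =>
    refine .inr ⟨r, b, hs, fun v ⟨q, hm⟩ => ?_, rfl⟩
    obtain ⟨hr, hb⟩ := Msg.aux.inj (mem_toAll.1 hm)
    exact Prod.ext hr hb
  | coinHit r est b h hc hv => exact .inl ⟨by ext; simp only [votes]; split_ifs <;> simp, rfl⟩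
  | _ => exact .inl ⟨by ext; simp [votes], rfl⟩

theorem Step.votesOk (h : Step n t s ev s' e) {x : Set (ℕ × Bool)} (hx : VotesOk x s) :
    VotesOk (x ∪ votes e) s' := by
  obtain ⟨hv, hs⟩ | ⟨r, b, hr, hv, hs⟩ := h.votes_subset
  · simpa only [hv, Set.union_empty] using ⟨hs ▸ hx.mem_auxSent, hx.unique⟩
  · have hfresh : ∀ b, (r, b) ∉ x := fun b hb => hr (hx.mem_auxSent r b hb)
    refine ⟨fun r' b' h' => ?_, fun r' b₁ b₂ h₁ h₂ => ?_⟩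
    · rw [hs, Finset.mem_insert]
      exact h'.symm.imp (fun h' => congrArg Prod.fst (hv h')) (hx.mem_auxSent r' b')
    · obtain h₁ | h₁ := h₁ <;> obtain h₂ | h₂ := h₂
      · exact hx.unique r' b₁ b₂ h₁ h₂
      · cases hv h₂; exact absurd h₁ (hfresh _)
      · cases hv h₁; exact absurd h₂ (hfresh _)
      · exact congrArg Prod.snd ((hv h₁).trans (hv h₂).symm)

theorem Step.received (h : Step n t s ev s' e) (hF : F.card ≤ t)
    (hrecv : ev.Delivers fun q m => q ∉ F → MsgOk t coin F X q m)
    (hs : Received t coin F X s) : Received t coin F X s' := by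
  cases h with
  | input b h hc => exact { hs with vals := fun V hV => by simpa [hc] using hs.vals V hV }
  | recvBval j r b h =>
    refine { hs with bvalRecv := fun r' b' j' hm hj => ?_ }
    obtain heq | hm := Finset.mem_insert.1 hm
    · cases heq; exact hrecv hj
    · exact hs.bvalRecv _ _ _ hm hj
  | recvAux j r b h hfirst =>
    refine { hs with auxRecv := fun r' b' j' hm hj => ?_ }
    obtain heq | hm := Finset.mem_insert.1 hm
    · cases heq; exact hrecv hj
    · exact hs.auxRecv _ _ _ hm hj
  | recvFinish j b h hfirst =>
    refine { hs with finishRecv := fun b' j' hm hj => ?_ }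
    obtain heq | hm := Finset.mem_insert.1 hm
    · cases heq; exact hrecv hj
    · exact hs.finishRecv _ _ hm hj
  | addBin r b h hc =>
    obtain ⟨j, hj, hm⟩ := exists_notMem_of_card_lt_nodeCount
      (show F.card < _ from lt_of_lt_of_le (by omega) hc)
    refine { hs with binVals := fun r' b' hb => ?_ }
    obtain heq | hb := Finset.mem_insert.1 hb
    · cases heq; exact hs.bvalRecv _ _ _ hm hj
    · exact hs.binVals _ _ hb
  | collect r est Q V h hc hv hs' hQ hQV hVQ hbin =>
    refine { hs with vals := ?_ }
    rintro _ ⟨⟩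
    refine ⟨r, est, hc, ⟨Q, hQ, fun j hj hjF => ?_⟩, fun b hb => hs.binVals _ _ (hbin b hb)⟩
    obtain ⟨b, hb, hbj⟩ := hQV j hj
    exact ⟨b, hb, hs.auxRecv _ _ _ hbj hjF⟩
  | coinMixed | coinMiss | coinHit => exact { hs with vals := by simp }
  | _ => exact { hs with }

theorem Step.msgOk (h : Step n t s ev s' e) (hn : 2 * t < n) (hF : F.card ≤ t)
    (hcoin : ev.AgreesWith coin) (hs : Received t coin F X s) (hvotes : votes e ⊆ X p)
    {q : Fin n} {m : Msg} (hm : (q, m) ∈ e.sends) : MsgOk t coin F X p m := by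
  cases h with
  | input b h hc => obtain rfl := mem_toAll.1 hm; exact .zero b
  | relayBval r b h hc hs' =>
    obtain rfl := mem_toAll.1 hm
    obtain ⟨j, hj, hmem⟩ := exists_notMem_of_card_lt_nodeCount (hF.trans_lt hc)
    exact hs.bvalRecv _ _ _ hmem hj
  | sendAux r est b h hc hb hs' => obtain rfl := mem_toAll.1 hm; exact hvotes ⟨q, hm⟩
  | coinMixed r est V b h hc hv hV =>
    obtain rfl := mem_toAll.1 hm
    obtain rfl : b = coin r := hcoin
    exact (hs.collected hc hv).estimate_coin hn hF hV
  | coinMiss r est b b' h hc hv hb =>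
    obtain rfl := mem_toAll.1 hm
    exact (hs.collected hc hv).estimate_singleton
  | coinHit r est b h hc hv =>
    have hcol := hs.collected hc hv
    obtain hm | hm := List.mem_append.1 hm
    · split_ifs at hm
      · cases hm
      · obtain rfl := mem_toAll.1 hm
        exact ⟨r, hcol, Eq.symm hcoin⟩
    · obtain rfl := mem_toAll.1 hm
      exact hcol.estimate_singleton
  | relayFinish b h hc hs' =>
    obtain rfl := mem_toAll.1 hm
    obtain ⟨j, hj, hmem⟩ := exists_notMem_of_card_lt_nodeCount (hF.trans_lt hc)
    exact hs.finishRecv _ _ hmem hj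
  | _ => cases hm

theorem Step.hit_of_out (h : Step n t s ev s' e) (hF : F.card ≤ t) (hs : Received t coin F X s)
    (hb : e.out = some b) : Hit t coin F X b := by
  cases h with
  | output b' h hc hs' =>
    cases hb
    obtain ⟨j, hj, hm⟩ := exists_notMem_of_card_lt_nodeCount
      (show F.card < _ from lt_of_lt_of_le (by omega) hc)
    exact hs.finishRecv _ _ hm hj
  | _ => cases hb

/-- The invariant of the binary agreement; the log of a node is the set of its `aux` messages. -/
def invariant (t : ℕ) (coin : ℕ → Bool) (F : Finset (Fin n)) :
    LogInvariant (protocol n t) (Set (ℕ × Bool)) where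
  StateOk X p s := VotesOk (X p) s ∧ Received t coin F X s
  MsgOk X p _ m := MsgOk t coin F X p m
  OutOk X b := Hit t coin F X b
  stateOk_mono hXY hp h := ⟨hp ▸ h.1, h.2.mono hXY⟩
  msgOk_mono hXY h := h.mono hXY
  outOk_mono hXY h := h.mono hXY

theorem Step.maintains (h : Step n t s ev s' e) (hn : 2 * t < n) (hF : F.card ≤ t)
    (hcoin : ev.AgreesWith coin)
    (hrecv : ev.Delivers fun q m => q ∉ F → MsgOk t coin F X q m)
    (hs : (invariant t coin F).StateOk X p s) :
    (invariant t coin F).Maintains X p s' e (X p ∪ votes e) := by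
  have hXY : X ≤ Function.update X p (X p ∪ votes e) :=
    le_update_self_iff.2 Set.subset_union_left
  have hvotes : votes e ⊆ Function.update X p (X p ∪ votes e) p := by simp
  refine ⟨Set.subset_union_left, ⟨?_, (h.received hF hrecv hs.2).mono hXY⟩, fun q m hm => ?_,
    fun b hb => (h.hit_of_out hF hs.2 hb).mono hXY⟩
  · simpa using h.votesOk hs.1
  · exact h.msgOk hn hF hcoin (hs.2.mono hXY) hvotes hm

theorem agreement (hn : 3 * t + 1 ≤ n) : Agreement (protocol n t) t := by
  intro coin c hc p q u v hp hq hu hv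
  have hF := hc.card_corrupted_le
  have hinit : ∀ p, (invariant t coin c.corrupted).StateOk (fun _ => ∅) p (protocol n t).init :=
    fun p => ⟨by constructor <;> simp, by constructor <;> simp [protocol]⟩
  obtain ⟨X, hX⟩ := (invariant t coin c.corrupted).exists_holds hinit
    (fun _ hs hcoin hrecv hst => ⟨_, Step.maintains hs (by omega) hF hcoin hrecv hst⟩)
    hc subset_rfl
  exact Hit.unique hn hF (fun j hj => (hX.state j hj).1.unique) (hX.outs p u hp hu)
    (hX.outs q v hq hv)

end ABBA

/-! ## Codes and pluralities -/

namespace ECC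

variable {n k κ : ℕ} {W A : Type}

theorem dec_eq_of_forall (code : ECC n k W A) {w : W} {obs : Fin n → Option A}
    (hobs : ∀ j y, obs j = some y → y = code.enc w j)
    (hk : k ≤ nodeCount fun j => ∃ y, obs j = some y) : code.dec obs = w := by
  classical
  refine code.dec_correct w obs 0 (by omega) ?_
  rw [nodeCount_eq_card_filter, Finset.filter_eq_empty_iff.2, Finset.card_empty]
  rintro j - ⟨y, hy, hne⟩
  exact hne (hobs j y hy)

theorem eq_of_le_nodeCount (code : ECC n k W A) {w w' : W}
    (h : k ≤ nodeCount fun j => code.enc w j = code.enc w' j) : w = w' := by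
  classical
  let obs : Fin n → Option A := fun j =>
    if code.enc w j = code.enc w' j then some (code.enc w j) else none
  have hk : k ≤ nodeCount fun j => ∃ y, obs j = some y := h.trans (nodeCount_mono fun j hj => by
    simp [obs, hj])
  have hw : code.dec obs = w := code.dec_eq_of_forall (fun j y hy => by grind) hk
  have hw' : code.dec obs = w' := code.dec_eq_of_forall (fun j y hy => by grind) hk
  exact hw.symm.trans hw'

open Classical in
theorem card_filter_enc_eq_le (code : ECC n (κ + 1) W A) {w w' : W} (h : w ≠ w') :
    (Finset.univ.filter fun j => code.enc w j = code.enc w' j).card ≤ κ := by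
  by_contra! hlt
  exact h (code.eq_of_le_nodeCount (by rwa [nodeCount_eq_card_filter]))

/-- If the nodes `i` and `j`, whose messages are `m i` and `m j`, exchange their symbols, they are
linked with each other. -/
def Compatible (code : ECC n k W A) (m : Fin n → Option W) (i j : Fin n) : Prop :=
  ∃ w w', m i = some w ∧ m j = some w' ∧ code.enc w i = code.enc w' i ∧ code.enc w j = code.enc w' j

theorem Compatible.enc_eq {code : ECC n k W A} {m : Fin n → Option W} {i j : Fin n}
    (h : code.Compatible m i j) {w w' : W} (hw : m i = some w) (hw' : m j = some w') :
    code.enc w i = code.enc w' i ∧ code.enc w j = code.enc w' j := by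
  obtain ⟨v, v', hv, hv', henc⟩ := h
  obtain rfl : w = v := Option.some.inj (hw.symm.trans hv)
  obtain rfl : w' = v' := Option.some.inj (hw'.symm.trans hv')
  exact henc

section Plurality

variable {code : ECC n (κ + 1) W A} {m : Fin n → Option W} {H B D : Finset (Fin n)} {w w' : W}

open Classical in
/-- The nodes of `H` with message `w`. -/
noncomputable def group (H : Finset (Fin n)) (m : Fin n → Option W) (w : W) : Finset (Fin n) :=
  H.filter fun j => m j = some w

open Classical in
/-- The nodes of `H` whose message is neither `w` nor `w'`. -/
noncomputable def rest (H : Finset (Fin n)) (m : Fin n → Option W) (w w' : W) : Finset (Fin n) :=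
  H.filter fun j => m j ≠ some w ∧ m j ≠ some w'

open Classical in
theorem card_filter_ne (hne : w ≠ w') :
    (H.filter fun j => m j ≠ some w).card = (group H m w').card + (rest H m w w').card := by
  have hdisj : Disjoint (group H m w') (rest H m w w') :=
    Finset.disjoint_filter.2 fun j _ h h' => h'.2 h
  rw [← Finset.card_union_of_disjoint hdisj]
  congr 1
  ext j
  simp only [group, rest, Finset.mem_union, Finset.mem_filter]
  grind

theorem card_group_add_card_group_add_card_rest (hne : w ≠ w') :
    (group H m w).card + (group H m w').card + (rest H m w w').card = H.card := by
  classical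
  rw [add_assoc, ← card_filter_ne hne]
  exact Finset.card_filter_add_card_filter_not _

open Classical in
theorem card_filter_compatible_le (hB : ∀ j ∈ B, ∀ v, m j = some v → code.enc w j = code.enc v j)
    {d : Fin n} (hd : m d ≠ some w) : (B.filter fun j => code.Compatible m j d).card ≤ κ := by
  by_cases hv : ∃ v, m d = some v
  · obtain ⟨v, hv⟩ := hv
    have hne : w ≠ v := fun h => hd (h ▸ hv)
    refine (Finset.card_le_card fun j hj => ?_).trans (code.card_filter_enc_eq_le hne)
    obtain ⟨hjB, hc⟩ := Finset.mem_filter.1 hj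
    obtain ⟨u, -, hu, -⟩ := id hc
    simpa using (hB j hjB u hu).trans (hc.enc_eq hu hv).1
  · rw [Finset.filter_eq_empty_iff.2]
    · exact Nat.zero_le κ
    · rintro j - ⟨-, v, -, hmd, -⟩
      exact hv ⟨v, hmd⟩

open Classical in
/-- Double counting of the compatible pairs in `B × D`. -/
theorem card_mul_sub_card_group_le {δ : ℕ}
    (hB : ∀ j ∈ B, ∀ v, m j = some v → code.enc w j = code.enc v j)
    (hdeg : ∀ j ∈ B, δ ≤ (H.filter (code.Compatible m j)).card)
    (hD : ∀ d ∈ D, m d ≠ some w)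
    (hcover : ∀ j ∈ B, ∀ d ∈ H, code.Compatible m j d → m d ≠ some w → d ∈ D) :
    B.card * (δ - (group H m w).card) ≤ D.card * κ := by
  refine Finset.card_mul_le_card_mul (code.Compatible m) (fun j hj => ?_)
    fun d hd => card_filter_compatible_le hB (hD d hd)
  rw [tsub_le_iff_right]
  refine (hdeg j hj).trans ((Finset.card_le_card fun d hd => ?_).trans (Finset.card_union_le _ _))
  obtain ⟨hdH, hc⟩ := Finset.mem_filter.1 hd
  by_cases hdw : m d = some w
  · simp [group, hdH, hdw]
  · simp [Finset.bipartiteAbove, hc, hcover j hj d hdH hc hdw]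

theorem plurality_arith {t h g g' ρ b c κ : ℕ} (hh : 4 * t + 1 ≤ h) (hg : g ≤ g')
    (hρ : g + g' + ρ = h) (hκ : 5 * κ ≤ t) (hc : h - 2 * t ≤ c)
    (hcx : c * (h - 2 * t - g) ≤ (g' + ρ) * κ) (hbx : b * (h - 2 * t - g) ≤ ρ * κ)
    (hcb : c ≤ b + κ + ρ) : False := by
  obtain ⟨x, hx⟩ : ∃ x, x = h - 2 * t - g := ⟨_, rfl⟩
  rw [← hx] at hcx hbx
  have hρx : ρ + 1 ≤ 2 * x := by omega
  have hb : b ≤ 2 * κ := by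
    refine Nat.le_of_mul_le_mul_right (c := x) (hbx.trans ?_) (by omega)
    nlinarith [Nat.mul_le_mul_right κ (show ρ ≤ 2 * x by omega)]
  have hxt : 7 * t + 10 ≤ 10 * x := by omega
  rw [show g' + ρ = 2 * t + x by omega] at hcx
  have hlow : (2 * t + 1) * x ≤ (2 * t + x) * κ := (Nat.mul_le_mul_right x (by omega)).trans hcx
  have hupp : (2 * t + x) * (5 * κ) ≤ (2 * t + x) * t := Nat.mul_le_mul_left _ hκ
  nlinarith [Nat.mul_le_mul_right t hxt]

open Classical in
/-- Suppose that `w'` is at least as frequent. The nodes compatible with `i` share a symbol of `w`,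
hence each node with another message is compatible with at most `κ` of them, while each of them
needs `#H - 2 t` compatible nodes and finds only few in the group of `w`. Double counting gives a
contradiction. -/
theorem card_group_lt_card_group {t : ℕ} {S : Fin n → Prop} {i : Fin n}
    (hH : 4 * t + 1 ≤ H.card) (hκ : 5 * κ ≤ t)
    (hS : ∀ j ∈ H, S j → H.card - 2 * t ≤ (H.filter (code.Compatible m j)).card)
    (hi : H.card - 2 * t ≤ (H.filter fun j => S j ∧ code.Compatible m i j).card)
    (hw : m i = some w) (hne : w ≠ w') : (group H m w').card < (group H m w).card := by
  by_contra! hle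
  set C := H.filter fun j => S j ∧ code.Compatible m i j
  set B := H.filter fun j => S j ∧ m j = some w ∧ code.enc w j ≠ code.enc w' j
  have hpart := card_group_add_card_group_add_card_rest (H := H) (m := m) hne
  have hC : ∀ j ∈ C, ∀ v, m j = some v → code.enc w j = code.enc v j := fun j hj v hv =>
    ((Finset.mem_filter.1 hj).2.2.enc_eq hw hv).2
  have hCcount : C.card * (H.card - 2 * t - (group H m w).card) ≤
      (H.filter fun d => m d ≠ some w).card * κ :=
    card_mul_sub_card_group_le hC
      (fun j hj => hS j (Finset.mem_filter.1 hj).1 (Finset.mem_filter.1 hj).2.1) (by simp)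
      (by grind)
  have hBcount : B.card * (H.card - 2 * t - (group H m w).card) ≤ (rest H m w w').card * κ := by
    refine card_mul_sub_card_group_le (code := code) (H := H) (w := w) (by grind)
      (fun j hj => ?_) (fun d hd => ?_) fun j hj d hd hc hdw => ?_
    · exact hS j (Finset.mem_filter.1 hj).1 (Finset.mem_filter.1 hj).2.1
    · exact (Finset.mem_filter.1 hd).2.1
    · obtain ⟨-, -, hjw, hj⟩ := Finset.mem_filter.1 hj
      exact Finset.mem_filter.2 ⟨hd, hdw, fun hdw' => hj (hc.enc_eq hjw hdw').1⟩
  have hcover : C ⊆ B ∪ (Finset.univ.filter fun j => code.enc w j = code.enc w' j) ∪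
      rest H m w w' := by
    intro j hj
    have hjw' := hC j hj w'
    simp only [B, C, rest, Finset.mem_union, Finset.mem_filter, Finset.mem_univ] at hj ⊢
    tauto
  have hcard := (Finset.card_le_card hcover).trans (Finset.card_union_le _ _)
  have hunion := Finset.card_union_le B (Finset.univ.filter fun j => code.enc w j = code.enc w' j)
  have hagree := code.card_filter_enc_eq_le hne
  rw [card_filter_ne hne] at hCcount
  exact plurality_arith hH hle hpart hκ hi hCcount hBcount (by omega)

end Plurality

end ECC

/-! ## Multi-valued agreement -/

namespace LiChen

variable {n t : ℕ} {W A : Type} {code : ECC n (dim t) W A} {p : Fin n} {s s' : State n W A}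
  {ev : Ev n W A} {e : Eff n W A}

section Binary

/-- The binary agreement. -/
def abbaInstance (t : ℕ) (code : ECC n (dim t) W A) :
    Subprotocol (protocol n t code) (ABBA.protocol n t) where
  msg m := match m with
    | .abba m' => some m'
    | _ => none
  coinId := some
  state s := s.abba
  started s := s.voted = true
  out s := s.abbaOut

theorem sends_lift (e : ABBA.Eff n) :
    (abbaInstance t code).sends (lift (W := W) (A := A) e).sends = e.sends :=
  Subprotocol.sends_map_self (E := abbaInstance t code) Msg.abba (fun _ => rfl) e.sends

theorem toss_lift (e : ABBA.Eff n) :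
    (lift (W := W) (A := A) e).toss.filterMap (abbaInstance t code).coinId = e.toss :=
  List.filterMap_some

theorem sends_toAll (m : Msg A) (h : (abbaInstance t code).msg m = none) :
    (abbaInstance t code).sends (toAll m) = [] :=
  Subprotocol.sends_map_of_eq_none (P := protocol n t code) _ (fun _ => h) _

theorem idle_of_eq (hev : (abbaInstance t code).Foreign ev) (habba : s'.abba = s.abba)
    (hout : s'.abbaOut = s.abbaOut) (hvoted : s'.voted = s.voted)
    (hsends : (abbaInstance t code).sends e.sends = []) (htoss : e.toss = []) :
    (abbaInstance t code).Idle s ev s' e where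
  foreign := hev
  state_eq := habba
  out_eq := hout
  started h := hvoted.trans h
  sends_eq := hsends
  toss_eq := by rw [htoss]; rfl

theorem active_withABBA {coin : ℕ → Bool} {a : ABBA.State n} {e : ABBA.Eff n}
    {ev' : NodeEvent n Bool ABBA.Msg ℕ fun _ => Bool}
    (hev : (abbaInstance t code).Corresponds coin (¬ s.voted = true) ev ev')
    (ha : ABBA.Step n t s.abba ev' a e) (hinput : ∀ v, ev' ≠ .input v) :
    (abbaInstance t code).Active coin p s ev (withABBA s a e) (lift e) ev' e where
  corresponds := hev
  step := ha
  out_eq := rfl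
  started h := h
  started_of_input v h := absurd h (hinput v)
  sends_eq := sends_lift e
  toss_eq := toss_lift e

theorem active_vote {coin : ℕ → Bool} {a : ABBA.State n} {e : ABBA.Eff n} {b : Bool}
    (hv : s.voted = false) (ha : ABBA.Step n t s.abba (.input b) a e) :
    (abbaInstance t code).Active coin p s .tau { withABBA s a e with voted := true } (lift e)
      (.input b) e where
  corresponds := .input b (by simp [abbaInstance, hv])
  step := ha
  out_eq := rfl
  started _ := rfl
  started_of_input _ _ := rfl
  sends_eq := sends_lift e
  toss_eq := toss_lift e

theorem Step.idle_or_active {coin : ℕ → Bool} (h : Step n t code p s ev s' e)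
    (hcoin : ev.AgreesWith coin) :
    (abbaInstance t code).Idle s ev s' e ∨
      ∃ ev' e', (abbaInstance t code).Active coin p s ev s' e ev' e' := by
  cases h with
  | input w h hw =>
    exact .inl (idle_of_eq trivial rfl rfl rfl
      (Subprotocol.sends_map_of_eq_none (P := protocol n t code) _ (fun _ => rfl) _) rfl)
  | recvSymbol | recvSi1 | recvSi2 | recvCorrect => exact .inl (idle_of_eq rfl rfl rfl rfl rfl rfl)
  | si1One | si1Zero | si2One | si2Zero | sendCorrect =>
    exact .inl (idle_of_eq trivial rfl rfl rfl (sends_toAll _ rfl) rfl)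
  | outputDefault | outputOwn | outputDecoded =>
    exact .inl (idle_of_eq trivial rfl rfl rfl rfl rfl)
  | voteOne a e h hv hn ha | voteZero a e h hv hn ha => exact .inr ⟨_, _, active_vote hv ha⟩
  | abbaRecv j m a e h ha =>
    exact .inr ⟨_, _, active_withABBA
      (Subprotocol.Corresponds.recv (P := protocol n t code) (Q := ABBA.protocol n t) j _ m rfl)
      ha nofun⟩
  | abbaCoin r b a e h ha =>
    obtain rfl : b = coin r := hcoin
    exact .inr ⟨_, _, active_withABBA
      (Subprotocol.Corresponds.coin (P := protocol n t code) (Q := ABBA.protocol n t) r _ r rfl)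
      ha nofun⟩
  | abbaTau a e h ha => exact .inr ⟨_, _, active_withABBA .tau ha nofun⟩

theorem embedded (t : ℕ) (code : ECC n (dim t) W A) (coin : ℕ → Bool) :
    (abbaInstance t code).Embedded coin coin where
  state_init := rfl
  out_init := rfl
  step h hcoin := Step.idle_or_active h hcoin

theorem Step.abbaOut_of_out (h : Step n t code p s ev s' e) {v : Option W} (hv : e.out = some v) :
    s.abbaOut = some v.isSome := by
  cases h with
  | outputDefault w h ha hw => cases hv; exact ha
  | outputOwn w h ha h2 hw => cases hv; exact ha
  | outputDecoded v w h ha => cases hv; exact ha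
  | _ => simp [lift] at hv

theorem isSome_eq_isSome_of_mem_outs (hn : 3 * t + 1 ≤ n) {coin : ℕ → Bool}
    {c : Config (protocol n t code)} (h : Reachable (protocol n t code) t coin c) {p q : Fin n}
    (hp : p ∉ c.corrupted) (hq : q ∉ c.corrupted) {u v : Option W} (hu : (p, u) ∈ c.outs)
    (hv : (q, v) ∈ c.outs) : u.isSome = v.isSome := by
  obtain ⟨D, hD, hcorr, -, hout⟩ := h.exists_instances (ι := Unit) (StateOk := fun _ _ => True)
    (OutOk := fun X v => v.isSome ∈ X ()) (fun _ => embedded t code coin) (fun _ _ => trivial)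
    (fun h hv => h () hv) (fun _ => trivial)
    fun hs _ ho _ => ⟨trivial, fun v hv => ho () _ (Step.abbaOut_of_out hs hv)⟩
  exact ABBA.agreement hn coin (D ()) (hD ()) p q _ _ (hcorr () ▸ hp) (hcorr () ▸ hq)
    (hout p u hu) (hout q v hv)

end Binary

/-- The public commitments of a node: its message, and its claims of success in the two phases. -/
structure Published (W : Type) : Type where
  msg : Option W
  succ₁ : Prop
  succ₂ : Prop

namespace Published

instance : Preorder (Published W) :=
  Preorder.lift fun x => ({w | x.msg = some w}, x.succ₁, x.succ₂)

theorem le_def {x y : Published W} :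
    x ≤ y ↔ (∀ w, x.msg = some w → y.msg = some w) ∧ (x.succ₁ → y.succ₁) ∧ (x.succ₂ → y.succ₂) :=
  Iff.rfl

end Published

/-- What a node with a given state has committed itself to. -/
def published (s : State n W A) : Published W where
  msg := s.msg
  succ₁ := s.si1Sent = some true
  succ₂ := s.si2Sent = some true

theorem Step.published_le (h : Step n t code p s ev s' e) : published s ≤ published s' := by
  rw [Published.le_def]
  cases h with
  | input w h hw => exact ⟨by simp [published, hw], id, id⟩
  | si1One h hs | si1Zero h hs => exact ⟨fun _ => id, by simp [published, hs], id⟩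
  | si2One h hs | si2Zero h hs => exact ⟨fun _ => id, id, by simp [published, hs]⟩
  | _ => exact ⟨fun _ => id, id, id⟩

section Commitments

variable {F : Finset (Fin n)} {X Y : Fin n → Published W} {q i j : Fin n}

/-- `y` is the coded symbol of node `j` for the message of a node outside `F` that has claimed
success in both phases. -/
def Kept (code : ECC n (dim t) W A) (F : Finset (Fin n)) (X : Fin n → Published W) (j : Fin n)
    (y : A) : Prop :=
  ∃ k ∉ F, (X k).succ₂ ∧ ∃ w, (X k).msg = some w ∧ y = code.enc w j

theorem Kept.mono (h : X ≤ Y) {y : A} : Kept code F X j y → Kept code F Y j y := by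
  rintro ⟨k, hk, hs, w, hw, hy⟩
  exact ⟨k, hk, (h k).2.2 hs, w, (h k).1 hw, hy⟩

/-- The message from node `p` to node `q` conforms to the commitments of the nodes. -/
def MsgOk (code : ECC n (dim t) W A) (F : Finset (Fin n)) (X : Fin n → Published W)
    (p q : Fin n) : Msg A → Prop
  | .symbol y z => ∃ w, (X p).msg = some w ∧ y = code.enc w q ∧ z = code.enc w p
  | .si1 b => b = true → (X p).succ₁
  | .si2 b => b = true → (X p).succ₂
  | .correct y => Kept code F X p y
  | .abba _ => True

theorem MsgOk.mono (h : X ≤ Y) {m : Msg A} (hm : MsgOk code F X p q m) : MsgOk code F Y p q m := by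
  cases m with
  | symbol y z => exact hm.imp fun w hw => ⟨(h p).1 hw.1, hw.2⟩
  | si1 b => exact fun hb => (h p).2.1 (hm hb)
  | si2 b => exact fun hb => (h p).2.2 (hm hb)
  | correct y => exact Kept.mono h hm
  | abba m => trivial

/-- What a node has received from the nodes outside `F` conforms to their commitments. -/
structure Received (code : ECC n (dim t) W A) (F : Finset (Fin n)) (X : Fin n → Published W)
    (p : Fin n) (s : State n W A) : Prop where
  symRecv : ∀ j yz, s.symRecv j = some yz → j ∉ F → MsgOk code F X j p (.symbol yz.1 yz.2)
  si1Recv : ∀ j b, s.si1Recv j = some b → j ∉ F → MsgOk code F X j p (.si1 b)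
  si2Recv : ∀ j b, s.si2Recv j = some b → j ∉ F → MsgOk code F X j p (.si2 b)
  correctRecv : ∀ j y, s.correctRecv j = some y → j ∉ F → MsgOk code F X j p (.correct y)

theorem forall_update_some {α : Type} {f : Fin n → Option α} {R : Fin n → α → Prop} {a : α}
    (hf : ∀ k b, f k = some b → R k b) (ha : R j a) :
    ∀ k b, Function.update f j (some a) k = some b → R k b := by
  intro k b hb
  by_cases hkj : k = j
  · subst hkj
    rw [Function.update_self] at hb
    exact Option.some.inj hb ▸ ha
  · exact hf k b (by rwa [Function.update_of_ne hkj] at hb)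

namespace Received

theorem mono (h : X ≤ Y) (hs : Received code F X p s) : Received code F Y p s where
  symRecv j yz h' hj := (hs.symRecv j yz h' hj).mono h
  si1Recv j b h' hj := (hs.si1Recv j b h' hj).mono h
  si2Recv j b h' hj := (hs.si2Recv j b h' hj).mono h
  correctRecv j y h' hj := (hs.correctRecv j y h' hj).mono h

theorem kept_of_majority (hs : Received code F X p s) (hF : F.card ≤ t) {y : A}
    (hn : t + 1 ≤ nodeCount fun j => s.si2Recv j = some true ∧ ∃ z, s.symRecv j = some (y, z)) :
    Kept code F X p y := by
  obtain ⟨j, hj, hsi, z, hyz⟩ := exists_notMem_of_card_lt_nodeCount (Nat.lt_of_le_of_lt hF hn)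
  obtain ⟨w, hw, hy, -⟩ := hs.symRecv j _ hyz hj
  exact ⟨j, hj, hs.si2Recv j _ hsi hj rfl, w, hw, hy⟩

theorem kept_of_symbols (hs : Received code F X p s) (hj : j ∉ F) {y : A}
    (hy : symbols s j = some y) : Kept code F X j y := by
  unfold symbols at hy
  split_ifs at hy with h
  · obtain ⟨yz, hyz, rfl⟩ := Option.map_eq_some_iff.1 hy
    obtain ⟨w, hw, -, hz⟩ := hs.symRecv j _ hyz hj
    exact ⟨j, hj, hs.si2Recv j _ h.1 hj rfl, w, hw, hz⟩
  · exact hs.correctRecv j _ hy hj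

theorem compatible (hs : Received code F X p s) (hp : X p = published s) (hj : j ∉ F)
    (hl : Linked code p s j) : code.Compatible (fun k => (X k).msg) p j := by
  obtain ⟨w, hw, hsym⟩ := hl
  obtain ⟨w', hw', hy, hz⟩ := hs.symRecv j _ hsym hj
  exact ⟨w, w', (congrArg Published.msg hp).trans hw, hw', hy, hz⟩

theorem step (h : Step n t code p s ev s' e)
    (hrecv : ev.Delivers fun q m => q ∉ F → MsgOk code F X q p m) (hs : Received code F X p s) :
    Received code F X p s' := by
  cases h with
  | recvSymbol j y z h hfirst =>
    exact { hs with symRecv := forall_update_some hs.symRecv hrecv }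
  | recvSi1 j b h hfirst => exact { hs with si1Recv := forall_update_some hs.si1Recv hrecv }
  | recvSi2 j b h hfirst => exact { hs with si2Recv := forall_update_some hs.si2Recv hrecv }
  | recvCorrect j y h hfirst =>
    exact { hs with correctRecv := forall_update_some hs.correctRecv hrecv }
  | _ => exact { hs with }

end Received

/-- Claims of success of node `i` are backed by compatible nodes outside `F`. -/
structure Endorsed (code : ECC n (dim t) W A) (F : Finset (Fin n)) (X : Fin n → Published W)
    (i : Fin n) (x : Published W) : Prop where
  succ₁ : x.succ₁ →
    Fᶜ.card - 2 * t ≤ nodeCount fun j => j ∉ F ∧ code.Compatible (fun k => (X k).msg) i j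
  succ₂ : x.succ₂ → Fᶜ.card - 2 * t ≤
    nodeCount fun j => j ∉ F ∧ (X j).succ₁ ∧ code.Compatible (fun k => (X k).msg) i j

namespace Endorsed

theorem mono {x : Published W} (h : X ≤ Y) (hx : Endorsed code F X i x) :
    Endorsed code F Y i x := by
  have hcomp (j) (hj : code.Compatible (fun k => (X k).msg) i j) :
      code.Compatible (fun k => (Y k).msg) i j := by
    obtain ⟨w, w', hw, hw', henc⟩ := hj
    exact ⟨w, w', (h i).1 hw, (h j).1 hw', henc⟩
  exact ⟨fun hx' => (hx.succ₁ hx').trans (nodeCount_mono fun j hj => ⟨hj.1, hcomp j hj.2⟩),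
    fun hx' => (hx.succ₂ hx').trans
      (nodeCount_mono fun j hj => ⟨hj.1, (h j).2.1 hj.2.1, hcomp j hj.2.2⟩)⟩

theorem step (h : Step n t code p s ev s' e) (hp : X p = published s)
    (hr : Received code F X p s) (hs : Endorsed code F X p (published s)) :
    Endorsed code F X p (published s') := by
  cases h with
  | si1One h hsent hn =>
    refine ⟨fun _ => ?_, hs.succ₂⟩
    exact (card_compl_sub_le_nodeCount_notMem F hn).trans
      (nodeCount_mono fun j hj => ⟨hj.1, hr.compatible hp hj.1 hj.2⟩)
  | si2One h hsent h1 hn =>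
    refine ⟨hs.succ₁, fun _ => ?_⟩
    exact (card_compl_sub_le_nodeCount_notMem F hn).trans (nodeCount_mono fun j hj =>
      ⟨hj.1, hr.si1Recv j _ hj.2.1 hj.1 rfl, hr.compatible hp hj.1 hj.2.2⟩)
  | si1Zero => exact ⟨by simp [published], hs.succ₂⟩
  | si2Zero => exact ⟨hs.succ₁, by simp [published]⟩
  | _ => exact ⟨hs.succ₁, hs.succ₂⟩

end Endorsed

/-- An output message shares with the messages of the nodes that have claimed success in both
phases as many symbols as determine a message. -/
def OutOk (code : ECC n (dim t) W A) (F : Finset (Fin n)) (X : Fin n → Published W)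
    (v : Option W) : Prop :=
  ∀ w, v = some w → dim t ≤ nodeCount fun j => Kept code F X j (code.enc w j)

/-- The commitments of the nodes as an invariant of the protocol. -/
def commitments (code : ECC n (dim t) W A) (F : Finset (Fin n)) :
    LogInvariant (protocol n t code) (Published W) where
  StateOk X p s := X p = published s ∧ Received code F X p s ∧ Endorsed code F X p (X p)
  MsgOk := MsgOk code F
  OutOk := OutOk code F
  stateOk_mono h hp hs := ⟨hp ▸ hs.1, hs.2.1.mono h, hp ▸ hs.2.2.mono h⟩
  msgOk_mono h hm := MsgOk.mono h hm
  outOk_mono h hv w hw := (hv w hw).trans (nodeCount_mono fun _ => Kept.mono h)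

theorem Step.msgOk (h : Step n t code p s ev s' e) (hF : F.card ≤ t)
    (hr : Received code F X p s) (hle : X ≤ Y) (hY : Y p = published s') {m : Msg A}
    (hm : (q, m) ∈ e.sends) : MsgOk code F Y p q m := by
  cases h with
  | input w h hw =>
    simp only [List.mem_map, Prod.mk.injEq] at hm
    obtain ⟨j, -, rfl, rfl⟩ := hm
    exact ⟨w, congrArg Published.msg hY, rfl, rfl⟩
  | si1One | si1Zero | si2One | si2Zero =>
    obtain rfl := mem_toAll.1 hm
    simp [MsgOk, hY, published]
  | sendCorrect y h ha h2 hs' hn =>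
    obtain rfl := mem_toAll.1 hm
    exact (hr.kept_of_majority hF hn).mono hle
  | voteOne | voteZero | abbaRecv | abbaCoin | abbaTau =>
    simp only [lift, List.mem_map, Prod.mk.injEq] at hm
    obtain ⟨x, -, rfl, rfl⟩ := hm
    trivial
  | _ => simp at hm

theorem Step.outOk (h : Step n t code p s ev s' e) (hdim : dim t ≤ n) (hF : F.card ≤ t)
    (hp : p ∉ F) (hX : X p = published s) (hr : Received code F X p s) {v : Option W}
    (hv : e.out = some v) : OutOk code F X v := by
  rintro w rfl
  cases h with
  | outputDefault => cases hv
  | outputOwn w h ha h2 hw =>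
    cases hv
    have hkept (j) : Kept code F X j (code.enc w j) :=
      ⟨p, hp, by simpa [hX, published] using h2, w, by simpa [hX, published] using hw, rfl⟩
    classical
    simpa [nodeCount_eq_card_filter, hkept] using hdim
  | outputDecoded v w h ha hmsg h2 hs' hw hn =>
    cases hv
    have hcount := nodeCount_le_nodeCount_notMem_add_card
      (fun j => symbols s j = some (code.enc w j)) F
    have hhonest : dim t ≤ nodeCount fun j => j ∉ F ∧ symbols s j = some (code.enc w j) := by omega
    exact hhonest.trans (nodeCount_mono fun j hj => hr.kept_of_symbols hj.1 hj.2)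
  | _ => simp [lift] at hv

theorem exists_commitments (hdim : dim t ≤ n) (hF : F.card ≤ t) {coin : ℕ → Bool}
    {c : Config (protocol n t code)} (h : Reachable (protocol n t code) t coin c)
    (hcF : c.corrupted ⊆ F) : ∃ X, (commitments code F).Holds F X c := by
  refine (commitments code F).exists_holds
    (X₀ := fun _ => published (protocol n t code).init) (fun p => ?_) ?_ h hcF
  · exact ⟨rfl, ⟨nofun, nofun, nofun, nofun⟩, ⟨nofun, nofun⟩⟩
  · intro X p s ev s' e hp hs _ hrecv ⟨hX, hr, he⟩
    have hpub : X p ≤ published s' := hX ▸ Step.published_le hs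
    have hle : X ≤ Function.update X p (published s') := le_update_self_iff.2 hpub
    refine ⟨published s', hpub, ⟨?_, ?_, ?_⟩, fun q m hm => ?_, fun v hv => ?_⟩
    · exact Function.update_self ..
    · exact (hr.step hs hrecv).mono hle
    · rw [Function.update_self]
      exact (Endorsed.step hs hX hr (hX ▸ he)).mono hle
    · exact Step.msgOk hs hF hr hle (Function.update_self ..) hm
    · exact (commitments code F).outOk_mono hle (Step.outOk hs hdim hF hp hX hr hv)

end Commitments

section Agreement

variable {F : Finset (Fin n)} {X : Fin n → Published W}

theorem msg_eq_of_endorsed (hn : 5 * t + 1 ≤ n) (hF : F.card ≤ t)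
    (h : ∀ i ∉ F, Endorsed code F X i (X i)) {i i' : Fin n} (hi : i ∉ F) (hi' : i' ∉ F)
    (hs : (X i).succ₂) (hs' : (X i').succ₂) {w w' : W} (hw : (X i).msg = some w)
    (hw' : (X i').msg = some w') : w = w' := by
  classical
  by_contra hne
  have hH : 4 * t + 1 ≤ Fᶜ.card := by
    rw [Finset.card_compl, Fintype.card_fin]
    omega
  have hlt {i : Fin n} {w w' : W} (hi : i ∉ F) (hs : (X i).succ₂) (hw : (X i).msg = some w)
      (hne : w ≠ w') : (ECC.group Fᶜ (fun k => (X k).msg) w').card <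
        (ECC.group Fᶜ (fun k => (X k).msg) w).card := by
    refine ECC.card_group_lt_card_group (code := code) (S := fun j => (X j).succ₁) hH
      (Nat.mul_div_le t 5) (fun j hj hSj => ?_) ?_ hw hne
    · rw [← nodeCount_notMem_and]
      exact (h j (Finset.mem_compl.1 hj)).succ₁ hSj
    · rw [← nodeCount_notMem_and]
      exact (h i hi).succ₂ hs
  exact lt_asymm (hlt hi hs hw hne) (hlt hi' hs' hw' (Ne.symm hne))

theorem exists_msg_eq_of_outOk (hn : 5 * t + 1 ≤ n) (hF : F.card ≤ t)
    (h : ∀ i ∉ F, Endorsed code F X i (X i)) {u : W}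
    (hu : OutOk code F X (some u)) : ∃ i ∉ F, (X i).succ₂ ∧ (X i).msg = some u := by
  obtain ⟨j, -, i, hi, hs, w, hw, -⟩ := exists_notMem_of_card_lt_nodeCount (F := ∅)
    ((Nat.succ_pos _).trans_le (hu u rfl))
  obtain rfl : u = w := by
    refine code.eq_of_le_nodeCount ((hu u rfl).trans (nodeCount_mono fun k hk => ?_))
    obtain ⟨i', hi', hs', w', hw', henc⟩ := hk
    rwa [msg_eq_of_endorsed hn hF h hi hi' hs hs' hw hw']
  exact ⟨i, hi, hs, hw⟩

theorem agreement (hn : 5 * t + 1 ≤ n) (code : ECC n (dim t) W A) :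
    Agreement (protocol n t code) t := by
  intro coin c hc p q u v hp hq hu hv
  have hF := hc.card_corrupted_le
  obtain ⟨X, hX⟩ := exists_commitments (by unfold dim; omega) hF hc subset_rfl
  have hend : ∀ i ∉ c.corrupted, Endorsed code c.corrupted X i (X i) := fun i hi =>
    let ⟨_, _, he⟩ := hX.state i hi
    he
  have hbit : u.isSome = v.isSome := isSome_eq_isSome_of_mem_outs (by omega) hc hp hq hu hv
  cases u with
  | none => exact (Option.isSome_eq_false_iff.1 hbit.symm |> Option.isNone_iff_eq_none.1).symm
  | some u =>
    obtain ⟨v, rfl⟩ := Option.isSome_iff_exists.1 hbit.symm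
    obtain ⟨i, hi, hs, hw⟩ := exists_msg_eq_of_outOk hn hF hend (hX.outs p _ hp hu)
    obtain ⟨i', hi', hs', hw'⟩ := exists_msg_eq_of_outOk hn hF hend (hX.outs q _ hq hv)
    rw [msg_eq_of_endorsed hn hF hend hi hi' hs hs' hw hw']

end Agreement

end LiChen

/-! ## Multi-valued agreement with an external predicate -/

namespace MVBARR

variable {n t : ℕ} {W A : Type} {pred : W → Bool} {code : ECC n (t + 1) W A}
  {aba : Protocol n W (Option W)} {l l' : Fin n} {p : Fin n} {s s' : State n W A aba.State}
  {ev : Ev A aba} {e : Eff A aba} {coin : (id : CoinId aba) → CoinVal aba id}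

section Instances

/-- The instance `l` of the Byzantine agreement. A node retrieving data for `l` is about to give it
an input whether or not it has done so before, so the instance counts as not yet started there. -/
def abaInstance (t : ℕ) (pred : W → Bool) (code : ECC n (t + 1) W A)
    (aba : Protocol n W (Option W)) (l : Fin n) :
    Subprotocol (protocol n t pred code aba) aba where
  msg m := match m with
    | .aba l' m' => if l' = l then some m' else none
    | _ => none
  coinId id := match id with
    | .inl _ => none
    | .inr x => if x.1 = l then some x.2 else none
  state s := s.aba l
  started s := l ∈ s.abaStarted ∧ ∀ r, s.loc ≠ .retrieving r l
  out s := s.abaOut l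

theorem sends_lift_self (e : Effects n (Option W) aba.Msg aba.CoinId) :
    (abaInstance t pred code aba l).sends (lift (A := A) aba l e).sends = e.sends :=
  Subprotocol.sends_map_self (P := protocol n t pred code aba) (.aba l) (fun _ => if_pos rfl) _

theorem toss_lift_self (e : Effects n (Option W) aba.Msg aba.CoinId) :
    (lift (A := A) aba l e).toss.filterMap (abaInstance t pred code aba l).coinId = e.toss :=
  Subprotocol.toss_map_self (P := protocol n t pred code aba) (fun id => .inr (l, id))
    (fun _ => if_pos rfl) _

theorem sends_lift_of_ne (h : l' ≠ l) (e : Effects n (Option W) aba.Msg aba.CoinId) :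
    (abaInstance t pred code aba l).sends (lift (A := A) aba l' e).sends = [] :=
  Subprotocol.sends_map_of_eq_none (P := protocol n t pred code aba) _ (fun _ => if_neg h) _

theorem toss_lift_of_ne (h : l' ≠ l) (e : Effects n (Option W) aba.Msg aba.CoinId) :
    (lift (A := A) aba l' e).toss.filterMap (abaInstance t pred code aba l).coinId = [] :=
  Subprotocol.toss_map_of_eq_none (P := protocol n t pred code aba) _ (fun _ => if_neg h) _

theorem sends_toAll (m : Msg n A aba.Msg) (h : (abaInstance t pred code aba l).msg m = none) :
    (abaInstance t pred code aba l).sends (toAll m) = [] :=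
  Subprotocol.sends_map_of_eq_none (P := protocol n t pred code aba) _ (fun _ => h) _

theorem idle_of_eq (hev : (abaInstance t pred code aba l).Foreign ev) (haba : s'.aba = s.aba)
    (hout : s'.abaOut = s.abaOut) (hstarted : s'.abaStarted = s.abaStarted)
    (hloc : ∀ r, s'.loc = .retrieving r l → s.loc = .retrieving r l ∨ l ∉ s.abaStarted)
    (hsends : (abaInstance t pred code aba l).sends e.sends = [])
    (htoss : e.toss.filterMap (abaInstance t pred code aba l).coinId = []) :
    (abaInstance t pred code aba l).Idle s ev s' e where
  foreign := hev
  state_eq := congrFun haba l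
  out_eq := congrFun hout l
  started h := ⟨hstarted ▸ h.1, fun r hr => (hloc r hr).elim (h.2 r) fun h' => h' h.1⟩
  sends_eq := hsends
  toss_eq := htoss

theorem idle_or_active_withABA {a : aba.State} {e : Effects n (Option W) aba.Msg aba.CoinId}
    {ev' : NodeEvent n W aba.Msg aba.CoinId aba.CoinVal}
    (hforeign : l' ≠ l → (abaInstance t pred code aba l).Foreign ev)
    (hev : ∀ fresh, (abaInstance t pred code aba l').Corresponds
      (fun id => coin (.inr (l', id))) fresh ev ev')
    (hinput : ∀ v, ev' ≠ .input v) (ha : aba.step p (s.aba l') ev' a e) :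
    (abaInstance t pred code aba l).Idle s ev (withABA aba s l' a e) (lift aba l' e) ∨
    ∃ ev' e', (abaInstance t pred code aba l).Active (fun id => coin (.inr (l, id))) p s ev
      (withABA aba s l' a e) (lift aba l' e) ev' e' := by
  by_cases hl : l' = l
  · subst hl
    exact .inr ⟨ev', e,
      { corresponds := hev _
        step := by simpa [abaInstance, withABA] using ha
        out_eq := by simp [abaInstance, withABA]
        started := id
        started_of_input := fun v hv => absurd hv (hinput v)
        sends_eq := sends_lift_self e
        toss_eq := toss_lift_self e }⟩
  · exact .inl
      { foreign := hforeign hl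
        state_eq := by simp [abaInstance, withABA, Ne.symm hl]
        out_eq := by simp [abaInstance, withABA, Ne.symm hl]
        started := id
        sends_eq := sends_lift_of_ne hl e
        toss_eq := toss_lift_of_ne hl e }

theorem idle_or_active_retrieved {a : aba.State} {e : Effects n (Option W) aba.Msg aba.CoinId}
    {r : ℕ} {w : W} (h : s.loc = .retrieving r l') (ha : aba.step p (s.aba l') (.input w) a e)
    (hs' : s' = { withABA aba s l' a e with
      loc := .agreeing r l', abaStarted := insert l' s.abaStarted }) :
    (abaInstance t pred code aba l).Idle s .tau s' (lift aba l' e) ∨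
    ∃ ev' e', (abaInstance t pred code aba l).Active (fun id => coin (.inr (l, id))) p s .tau s'
      (lift aba l' e) ev' e' := by
  subst hs'
  by_cases hl : l' = l
  · subst hl
    exact .inr ⟨.input w, e,
      { corresponds := .input w fun h' => h'.2 r h
        step := by simpa [abaInstance, withABA] using ha
        out_eq := by simp [abaInstance, withABA]
        started := fun h' => absurd h (h'.2 r)
        started_of_input := fun _ _ => ⟨Finset.mem_insert_self _ _, by simp⟩
        sends_eq := sends_lift_self e
        toss_eq := toss_lift_self e }⟩
  · exact .inl
      { foreign := trivial
        state_eq := by simp [abaInstance, withABA, Ne.symm hl]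
        out_eq := by simp [abaInstance, withABA, Ne.symm hl]
        started := fun h' => ⟨Finset.mem_insert_of_mem h'.1, by simp⟩
        sends_eq := sends_lift_of_ne hl e
        toss_eq := toss_lift_of_ne hl e }

theorem Step.idle_or_active (h : Step n t pred code aba p s ev s' e) (hcoin : ev.AgreesWith coin) :
    (abaInstance t pred code aba l).Idle s ev s' e ∨
    ∃ ev' e', (abaInstance t pred code aba l).Active (fun id => coin (.inr (l, id))) p s ev s' e
      ev' e' := by
  cases h with
  | input w h hw =>
    exact .inl (idle_of_eq trivial rfl rfl rfl nofun
      (Subprotocol.sends_map_of_eq_none (P := protocol n t pred code aba) _ (fun _ => rfl) _) rfl)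
  | recvShare | recvVote | recvElection | recvConfirm | recvEcho =>
    exact .inl (idle_of_eq rfl rfl rfl rfl (fun _ => .inl) rfl rfl)
  | sendElection | sendConfirm =>
    exact .inl (idle_of_eq trivial rfl rfl rfl (fun _ => .inl) (sends_toAll _ rfl) rfl)
  | disperseReturn h hn =>
    refine .inl (idle_of_eq trivial rfl rfl rfl nofun ?_ rfl)
    dsimp only
    split_ifs
    · rfl
    · exact sends_toAll _ rfl
  | elected r l' h hl =>
    refine .inl (idle_of_eq rfl rfl rfl rfl (fun r' hr => .inr ?_) (sends_toAll _ rfl) rfl)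
    cases hr
    exact hl
  | electedAgain => exact .inl (idle_of_eq rfl rfl rfl rfl nofun rfl rfl)
  | retrieved r l' w a e h hn hw ha => exact idle_or_active_retrieved h ha rfl
  | abaRecv j l' m a e h ha =>
    exact idle_or_active_withABA (fun hl => if_neg hl)
      (fun _ => .recv j _ m (if_pos rfl)) nofun ha
  | abaCoin l' id v a e h ha =>
    obtain rfl : v = coin (.inr (l', id)) := hcoin
    exact idle_or_active_withABA (fun hl => if_neg hl)
      (fun _ => .coin _ _ id (if_pos rfl)) nofun ha
  | abaTau l' a e h ha =>
    exact idle_or_active_withABA (fun _ => trivial) (fun _ => .tau) nofun ha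
  | output | nextRound | lastRound => exact .inl (idle_of_eq trivial rfl rfl rfl nofun rfl rfl)

theorem embedded (t : ℕ) (pred : W → Bool) (code : ECC n (t + 1) W A)
    (aba : Protocol n W (Option W)) (coin : (id : CoinId aba) → CoinVal aba id) (l : Fin n) :
    (abaInstance t pred code aba l).Embedded coin fun id => coin (.inr (l, id)) where
  state_init := rfl
  out_init := rfl
  step h hcoin := Step.idle_or_active h hcoin

end Instances

section Rounds

variable {elect : ℕ → Fin n} {X Y : Fin n → Set (Option W)} {r r' : ℕ} {u v : W}

/-- A node that has got the outputs `X` from the instances may have been through the rounds before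
`r`: the node elected in each of them has an instance with an output that is not acceptable. -/
def Passed (pred : W → Bool) (elect : ℕ → Fin n) (X : Fin n → Set (Option W)) (r : ℕ) : Prop :=
  ∀ r', 1 ≤ r' → r' < r → ∃ o ∈ X (elect r'), ∀ w, o = some w → pred w = false

theorem Passed.mono (hXY : X ≤ Y) (h : Passed pred elect X r) : Passed pred elect Y r :=
  fun r' h₁ h₂ =>
    let ⟨o, ho, hw⟩ := h r' h₁ h₂
    ⟨o, hXY _ ho, hw⟩

/-- A node that has got the outputs `X` from the instances may be at a location. -/
def LocOk (pred : W → Bool) (elect : ℕ → Fin n) (X : Fin n → Set (Option W)) : Loc n → Prop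
  | .electing r => 1 ≤ r ∧ Passed pred elect X r
  | .retrieving r l | .agreeing r l => 1 ≤ r ∧ l = elect r ∧ Passed pred elect X r
  | _ => True

theorem LocOk.mono (hXY : X ≤ Y) {loc : Loc n} (h : LocOk pred elect X loc) :
    LocOk pred elect Y loc := by
  cases loc with
  | electing r => exact ⟨h.1, h.2.mono hXY⟩
  | retrieving r l | agreeing r l => exact ⟨h.1, h.2.1, h.2.2.mono hXY⟩
  | _ => trivial

/-- A node that has got the outputs `X` from the instances may output `u`: this is the acceptable
output of the instance of the node elected in some round. -/
def OutOk (pred : W → Bool) (elect : ℕ → Fin n) (X : Fin n → Set (Option W)) (u : W) : Prop :=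
  ∃ r, 1 ≤ r ∧ Passed pred elect X r ∧ some u ∈ X (elect r) ∧ pred u = true

theorem OutOk.mono (hXY : X ≤ Y) (h : OutOk pred elect X u) : OutOk pred elect Y u :=
  let ⟨r, hr, hpassed, hu, hpred⟩ := h
  ⟨r, hr, hpassed.mono hXY, hXY _ hu, hpred⟩

theorem Step.locOk_and_outOk (h : Step n t pred code aba p s ev s' e) (hcoin : ev.AgreesWith coin)
    (hX : ∀ l o, s.abaOut l = some o → o ∈ X l)
    (hloc : LocOk pred (fun r => coin (.inl r)) X s.loc) :
    LocOk pred (fun r => coin (.inl r)) X s'.loc ∧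
      ∀ u, e.out = some u → OutOk pred (fun r => coin (.inl r)) X u := by
  cases h with
  | input | lastRound => exact ⟨trivial, nofun⟩
  | disperseReturn h hn => exact ⟨⟨le_rfl, fun r' h₁ h₂ => absurd h₁ (not_le.2 h₂)⟩, nofun⟩
  | elected r l h hl | electedAgain r l h hl =>
    rw [h] at hloc
    exact ⟨⟨hloc.1, hcoin, hloc.2⟩, nofun⟩
  | retrieved r l w a e h hn hw ha =>
    rw [h] at hloc
    exact ⟨hloc, nofun⟩
  | output r l w h ho hw =>
    rw [h] at hloc
    obtain ⟨hr, rfl, hpassed⟩ := hloc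
    refine ⟨trivial, ?_⟩
    rintro u ⟨⟩
    exact ⟨r, hr, hpassed, hX _ _ ho, hw⟩
  | nextRound r l o h ho hw hr =>
    rw [h] at hloc
    obtain ⟨-, rfl, hpassed⟩ := hloc
    refine ⟨⟨Nat.succ_pos r, fun r' h₁ h₂ => ?_⟩, nofun⟩
    obtain hlt | rfl := Nat.lt_succ_iff_lt_or_eq.1 h₂
    · exact hpassed r' h₁ hlt
    · exact ⟨o, hX _ _ ho, hw⟩
  | _ => exact ⟨hloc, nofun⟩

theorem Passed.le (h : Passed pred elect Y r') (hr : 1 ≤ r) (hu : ∀ o ∈ Y (elect r), o = some u)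
    (hpred : pred u = true) : r' ≤ r := by
  by_contra! hlt
  obtain ⟨o, ho, hw⟩ := h r hr hlt
  exact Bool.false_ne_true ((hw u (hu o ho)).symm.trans hpred)

theorem OutOk.eq (hXY : ∀ l, ∀ o ∈ X l, ∀ o' ∈ Y l, o = o') (hu : OutOk pred elect X u)
    (hv : OutOk pred elect Y v) : u = v := by
  obtain ⟨r, hr, hpassed, hu, hpred⟩ := hu
  obtain ⟨r', hr', hpassed', hv, hpred'⟩ := hv
  obtain rfl : r = r' := le_antisymm
    (hpassed.le hr' (fun o ho => hXY _ o ho _ hv) hpred')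
    (hpassed'.le hr (fun o ho => (hXY _ _ hu o ho).symm) hpred)
  exact Option.some.inj (hXY _ _ hu _ hv)

end Rounds

end MVBARR

theorem mainTheorem4_general {n t f : ℕ} {W A : Type} {pred : W → Bool} {code : ECC n (t + 1) W A}
    {aba : Protocol n W (Option W)} (h : Agreement aba f) :
    Agreement (MVBARR.protocol n t pred code aba) f := by
  intro coin c hc p q u v hp hq hu hv
  obtain ⟨D, hD, hcorr, -, hout⟩ := hc.exists_instances
    (MVBARR.embedded t pred code aba coin)
    (StateOk := fun X s => MVBARR.LocOk pred (fun r => coin (.inl r)) X s.loc)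
    (OutOk := MVBARR.OutOk pred fun r => coin (.inl r))
    (fun hXY hs => hs.mono hXY) (fun hXY hv => hv.mono hXY) (fun _ => trivial)
    fun hs hcoin hX hloc => MVBARR.Step.locOk_and_outOk hs hcoin hX hloc
  exact MVBARR.OutOk.eq
    (fun l _ ho _ ho' => h _ (D l) (hD l) p q _ _ (hcorr l ▸ hp) (hcorr l ▸ hq) ho ho')
    (hout p u hu) (hout q v hv)

/-- Agreement of OciorMVBA-RR-IT for `n ≥ 5 t + 1`, with the Byzantine agreement protocol for
`n ≥ 5 t + 1` built above, and more generally with any protocol in its place whose honest nodes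
never output different values. -/
theorem mainTheorem4 (n t : ℕ) (hn : 5 * t + 1 ≤ n) (W A B : Type) (pred : W → Bool)
    (code : ECC n (t + 1) W A) (abaCode : ECC n (LiChen.dim t) W B) :
    Agreement (MVBARR.protocol n t pred code (LiChen.protocol n t abaCode)) t ∧
    ∀ aba : Protocol n W (Option W), Agreement aba t →
      Agreement (MVBARR.protocol n t pred code aba) t := by
  exact ⟨mainTheorem4_general (LiChen.agreement hn abaCode), fun _ => mainTheorem4_general⟩
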